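/- Let $n\ge 0$ and $m,r,l\ge 1$ be integers, let $1\le p\le\infty$, and let $[a,b]\subset\mathbb R$ be a compact interval with $a<b$. Let $W^0_p=L_p([a,b];\mathbb C)$ and, for $k\ge1$, let $W^k_p$ be the space of all $y\in C^{k-1}([a,b];\mathbb C)$ such that $y^{(k-1)}$ is absolutely continuous on $[a,b]$ and $y^{(k)}\in L_p$, with the norm $\|y\|_{k,p}=\sum_{j=0}^{k}\|y^{(j)}\|_{L_p}$. Let $(W^k_p)^m$ be the space of $\mathbb C^m$-valued functions with components in $W^k_p$, normed by the sum of the norms of the components. Let $A_0,\dots,A_{r-1}$ be $m\times m$ matrix-valued functions with entries in $W^n_p$, put $$(Ly)(t)=y^{(r)}(t)+\sum_{j=1}^{r}A_{r-j}(t)\,y^{(r-j)}(t),\qquad y\in (W^{n+r}_p)^m,$$ and let $B\colon (W^{n+r}_p)^m\to\mathbb C^l$ be an arbitrary bounded linear operator. Then $y\mapsto (Ly,By)$ defines a bounded linear operator $$(L,B)\colon (W^{n+r}_p)^m\to (W^n_p)^m\times\mathbb C^l,$$ and this operator is Fredholm (its kernel and cokernel are finite-dimensional, and its range is closed), with index $$\dim\ker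 (L,B)-\dim\operatorname{coker}(L,B)=rm-l .$$ -/

import Mathlib

open MeasureTheory Set

noncomputable section

namespace SobolevBVP

/-- Lebesgue measure on the interval `[a, b]`. -/
abbrev intervalMeasure (a b : ℝ) : Measure ℝ := volume.restrict (Icc a b)

/-- The functions of class `W^k_p([a, b]; ℂ)`. For `k = 0` these are the functions in `L_p`; for
`k ≥ 1` they are the functions of class `C^(k-1)` on `[a, b]` whose derivative of order `k - 1` is
absolutely continuous on `[a, b]` and whose derivative of order `k` (which then exists almost
everywhere) lies in `L_p`. Derivatives are taken within `[a, b]`, that is, one-sided at the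
endpoints. -/
def IsSobolevFun : ℕ → ENNReal → ℝ → ℝ → (ℝ → ℂ) → Prop
  | 0, p, a, b, y => MemLp y p (intervalMeasure a b)
  | k + 1, p, a, b, y =>
      ContDiffOn ℝ (k : WithTop ℕ∞) y (Icc a b) ∧
      AbsolutelyContinuousOnInterval (iteratedDerivWithin k y (Icc a b)) a b ∧
      MemLp (iteratedDerivWithin (k + 1) y (Icc a b)) p (intervalMeasure a b)

section helpers

variable {k : ℕ} {p : ENNReal} {a b : ℝ}

theorem absolutelyContinuous_congr {f g : ℝ → ℂ} (hab : a < b) (h : EqOn f g (Icc a b))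
    (hf : AbsolutelyContinuousOnInterval f a b) : AbsolutelyContinuousOnInterval g a b := by
  rw [absolutelyContinuousOnInterval_iff] at hf ⊢
  intro ε hε
  obtain ⟨δ, hδ, H⟩ := hf ε hε
  refine ⟨δ, hδ, fun E hE hlt => ?_⟩
  have := H E hE hlt
  rw [← uIcc_of_le hab.le] at h
  have hs : ∑ i ∈ Finset.range E.1, dist (g (E.2 i).1) (g (E.2 i).2)
      = ∑ i ∈ Finset.range E.1, dist (f (E.2 i).1) (f (E.2 i).2) := by
    refine Finset.sum_congr rfl fun i hi => ?_
    rw [h (hE.1 i hi).1, h (hE.1 i hi).2]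
  rwa [hs]

theorem ae_differentiableWithinAt_of_absolutelyContinuous {f : ℝ → ℂ} (hab : a < b)
    (hf : AbsolutelyContinuousOnInterval f a b) :
    ∀ᵐ t ∂(intervalMeasure a b), DifferentiableWithinAt ℝ f (Icc a b) t := by
  have h := hf.boundedVariationOn.locallyBoundedVariationOn.ae_differentiableWithinAt_of_mem
  rw [uIcc_of_le hab.le] at h
  exact (ae_restrict_iff' measurableSet_Icc).2 h

theorem iteratedDerivWithin_add_eqOn {j : ℕ} {y z : ℝ → ℂ} (hab : a < b)
    (hy : ContDiffOn ℝ (j : WithTop ℕ∞) y (Icc a b))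
    (hz : ContDiffOn ℝ (j : WithTop ℕ∞) z (Icc a b)) :
    EqOn (iteratedDerivWithin j (y + z) (Icc a b))
      (iteratedDerivWithin j y (Icc a b) + iteratedDerivWithin j z (Icc a b)) (Icc a b) :=
  fun _ ht => iteratedDerivWithin_add ht (uniqueDiffOn_Icc hab) (hy _ ht) (hz _ ht)

theorem iteratedDerivWithin_succ_add_ae {y z : ℝ → ℂ} (hab : a < b)
    (hy : IsSobolevFun (k + 1) p a b y) (hz : IsSobolevFun (k + 1) p a b z) :
    iteratedDerivWithin (k + 1) (y + z) (Icc a b) =ᵐ[intervalMeasure a b]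
      iteratedDerivWithin (k + 1) y (Icc a b) + iteratedDerivWithin (k + 1) z (Icc a b) := by
  have hE := iteratedDerivWithin_add_eqOn hab hy.1 hz.1
  filter_upwards [ae_differentiableWithinAt_of_absolutelyContinuous hab hy.2.1,
    ae_differentiableWithinAt_of_absolutelyContinuous hab hz.2.1,
    ae_restrict_mem measurableSet_Icc] with t h1 h2 ht
  rw [Pi.add_apply, iteratedDerivWithin_succ, iteratedDerivWithin_succ, iteratedDerivWithin_succ,
    derivWithin_congr hE (hE ht), derivWithin_add h1 h2]

theorem IsSobolevFun.add {y z : ℝ → ℂ} (hab : a < b)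
    (hy : IsSobolevFun k p a b y) (hz : IsSobolevFun k p a b z) :
    IsSobolevFun k p a b (y + z) := by
  cases k with
  | zero => exact MemLp.add hy hz
  | succ k =>
    refine ⟨hy.1.add hz.1, ?_, ?_⟩
    · exact absolutelyContinuous_congr hab (iteratedDerivWithin_add_eqOn hab hy.1 hz.1).symm
        (hy.2.1.add hz.2.1)
    · exact (memLp_congr_ae (iteratedDerivWithin_succ_add_ae hab hy hz)).2 (hy.2.2.add hz.2.2)

theorem IsSobolevFun.const_smul {y : ℝ → ℂ} (c : ℂ) (hy : IsSobolevFun k p a b y) :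
    IsSobolevFun k p a b (c • y) := by
  cases k with
  | zero => exact MemLp.const_smul hy c
  | succ k =>
    refine ⟨hy.1.const_smul c, ?_, ?_⟩
    · have : iteratedDerivWithin k (c • y) (Icc a b)
          = fun t => c • iteratedDerivWithin k y (Icc a b) t := by
        funext t; exact iteratedDerivWithin_const_smul_field c y
      rw [this]
      exact hy.2.1.const_smul c
    · have : iteratedDerivWithin (k + 1) (c • y) (Icc a b)
          = c • iteratedDerivWithin (k + 1) y (Icc a b) := by
        funext t; exact iteratedDerivWithin_const_smul_field c y
      rw [this]
      exact hy.2.2.const_smul c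

theorem isSobolevFun_zero : IsSobolevFun k p a b 0 := by
  cases k with
  | zero => exact MemLp.zero
  | succ k =>
    have h (j : ℕ) : iteratedDerivWithin j (0 : ℝ → ℂ) (Icc a b) = 0 := by
      funext t
      simp
    refine ⟨contDiffOn_const, ?_, ?_⟩
    · rw [h, absolutelyContinuousOnInterval_iff]
      exact fun ε hε => ⟨1, one_pos, fun E _ _ => by simpa using hε⟩
    · rw [h]; exact MemLp.zero

/-- All derivatives of order at most `k` of a function of class `W^k_p` lie in `L_p`. -/
theorem IsSobolevFun.memLp_iteratedDerivWithin {y : ℝ → ℂ} (hab : a < b)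
    (hy : IsSobolevFun k p a b y) (j : Fin (k + 1)) :
    MemLp (iteratedDerivWithin j y (Icc a b)) p (intervalMeasure a b) := by
  cases k with
  | zero =>
    obtain rfl : j = 0 := Fin.ext (by omega)
    simpa [IsSobolevFun] using hy
  | succ k =>
    rcases Nat.lt_or_ge (j : ℕ) (k + 1) with hj | hj
    · have hc : ContinuousOn (iteratedDerivWithin j y (Icc a b)) (Icc a b) :=
        hy.1.continuousOn_iteratedDerivWithin (by exact_mod_cast Nat.lt_succ_iff.1 hj)
          (uniqueDiffOn_Icc hab)
      obtain ⟨C, hC⟩ := isCompact_Icc.exists_bound_of_continuousOn hc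
      exact MemLp.of_bound (hc.aestronglyMeasurable measurableSet_Icc) C
        ((ae_restrict_iff' measurableSet_Icc).2 (Filter.Eventually.of_forall hC))
    · have : (j : ℕ) = k + 1 := by have := j.2; omega
      rw [this]
      exact hy.2.2

/-- The derivatives depend, up to null sets, only on the class of the function. -/
theorem iteratedDerivWithin_ae_congr {y z : ℝ → ℂ} (hab : a < b)
    (hy : IsSobolevFun k p a b y) (hz : IsSobolevFun k p a b z)
    (h : y =ᵐ[intervalMeasure a b] z) (j : Fin (k + 1)) :
    iteratedDerivWithin j y (Icc a b) =ᵐ[intervalMeasure a b]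
      iteratedDerivWithin j z (Icc a b) := by
  cases k with
  | zero =>
    obtain rfl : j = 0 := Fin.ext (by omega)
    simpa using h
  | succ k =>
    have hE : EqOn y z (Icc a b) :=
      Measure.eqOn_Icc_of_ae_eq volume hab.ne h hy.1.continuousOn hz.1.continuousOn
    filter_upwards [ae_restrict_mem measurableSet_Icc] with t ht
    exact iteratedDerivWithin_congr hE ht

theorem iteratedDerivWithin_add_ae {y z : ℝ → ℂ} (hab : a < b)
    (hy : IsSobolevFun k p a b y) (hz : IsSobolevFun k p a b z) (j : Fin (k + 1)) :
    iteratedDerivWithin j (y + z) (Icc a b) =ᵐ[intervalMeasure a b]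
      iteratedDerivWithin j y (Icc a b) + iteratedDerivWithin j z (Icc a b) := by
  cases k with
  | zero =>
    obtain rfl : j = 0 := Fin.ext (by omega)
    simp
  | succ k =>
    rcases Nat.lt_or_ge (j : ℕ) (k + 1) with hj | hj
    · have hjk : ((j : ℕ) : WithTop ℕ∞) ≤ (k : WithTop ℕ∞) := by
        exact_mod_cast Nat.lt_succ_iff.1 hj
      filter_upwards [ae_restrict_mem measurableSet_Icc] with t ht
      exact iteratedDerivWithin_add_eqOn hab (hy.1.of_le hjk) (hz.1.of_le hjk) ht
    · have : (j : ℕ) = k + 1 := by have := j.2; omega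
      rw [this]
      exact iteratedDerivWithin_succ_add_ae hab hy hz

end helpers

/-- The classes in `L_p([a, b]; ℂ)` that have a representative of class `W^k_p`. -/
def sobolevSubmodule (k : ℕ) (p : ENNReal) (a b : ℝ) [hab : Fact (a < b)] :
    Submodule ℂ (Lp ℂ p (intervalMeasure a b)) where
  carrier := {u | ∃ y : ℝ → ℂ, IsSobolevFun k p a b y ∧ u =ᵐ[intervalMeasure a b] y}
  add_mem' := by
    rintro u v ⟨y, hy, huy⟩ ⟨z, hz, hvz⟩
    exact ⟨y + z, hy.add hab.out hz, (Lp.coeFn_add u v).trans (huy.add hvz)⟩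
  zero_mem' := ⟨0, isSobolevFun_zero, Lp.coeFn_zero _ _ _⟩
  smul_mem' := by
    rintro c u ⟨y, hy, huy⟩
    exact ⟨c • y, hy.const_smul c, (Lp.coeFn_smul c u).trans (huy.const_smul c)⟩

/-- The complex Sobolev space `W^k_p([a, b]; ℂ)`, with functions identified when they agree almost
everywhere on `[a, b]`; its norm, the sum of the `L_p` norms of the derivatives of orders
`0, …, k`, is introduced below. -/
def Sobolev (k : ℕ) (p : ENNReal) (a b : ℝ) [Fact (a < b)] : Type :=
  ↥(sobolevSubmodule k p a b)

namespace Sobolev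

variable {k : ℕ} {p : ENNReal} {a b : ℝ} [hab : Fact (a < b)]

instance : AddCommGroup (Sobolev k p a b) :=
  inferInstanceAs (AddCommGroup ↥(sobolevSubmodule k p a b))

instance : Module ℂ (Sobolev k p a b) :=
  inferInstanceAs (Module ℂ ↥(sobolevSubmodule k p a b))

/-- The underlying element of `L_p`. -/
def toLp (u : Sobolev k p a b) : Lp ℂ p (intervalMeasure a b) :=
  Subtype.val (p := (· ∈ sobolevSubmodule k p a b)) u

/-- An element of the Sobolev space as a function (determined almost everywhere on `[a, b]`). -/
instance : CoeFun (Sobolev k p a b) (fun _ => ℝ → ℂ) := ⟨fun u => (u.toLp : ℝ → ℂ)⟩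

/-- A representative of class `W^k_p`; for `k ≥ 1` it is unique on `[a, b]`. -/
def rep (u : Sobolev k p a b) : ℝ → ℂ :=
  Classical.choose (Subtype.property (p := (· ∈ sobolevSubmodule k p a b)) u)

theorem isSobolevFun_rep (u : Sobolev k p a b) : IsSobolevFun k p a b u.rep :=
  (Classical.choose_spec (Subtype.property (p := (· ∈ sobolevSubmodule k p a b)) u)).1

theorem coeFn_ae_eq_rep (u : Sobolev k p a b) : u =ᵐ[intervalMeasure a b] u.rep :=
  (Classical.choose_spec (Subtype.property (p := (· ∈ sobolevSubmodule k p a b)) u)).2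

/-- The derivative `u^(j)` of order `j ≤ k` of `u ∈ W^k_p`, as an element of `L_p`. -/
def derivative (j : Fin (k + 1)) : Sobolev k p a b →ₗ[ℂ] Lp ℂ p (intervalMeasure a b) where
  toFun u := (u.isSobolevFun_rep.memLp_iteratedDerivWithin hab.out j).toLp
    (iteratedDerivWithin j u.rep (Icc a b))
  map_add' u v := by
    rw [← MemLp.toLp_add]
    refine MemLp.toLp_congr _ _ ?_
    have h : (u + v).rep =ᵐ[intervalMeasure a b] u.rep + v.rep :=
      ((u + v).coeFn_ae_eq_rep.symm.trans (Lp.coeFn_add u.toLp v.toLp)).trans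
        (u.coeFn_ae_eq_rep.add v.coeFn_ae_eq_rep)
    exact (iteratedDerivWithin_ae_congr hab.out (u + v).isSobolevFun_rep
      (u.isSobolevFun_rep.add hab.out v.isSobolevFun_rep) h j).trans
      (iteratedDerivWithin_add_ae hab.out u.isSobolevFun_rep v.isSobolevFun_rep j)
  map_smul' c u := by
    rw [RingHom.id_apply, ← MemLp.toLp_const_smul]
    refine MemLp.toLp_congr _ _ ?_
    have h : (c • u).rep =ᵐ[intervalMeasure a b] c • u.rep :=
      ((c • u).coeFn_ae_eq_rep.symm.trans (Lp.coeFn_smul c u.toLp)).trans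
        (u.coeFn_ae_eq_rep.const_smul c)
    refine (iteratedDerivWithin_ae_congr hab.out (c • u).isSobolevFun_rep
      (u.isSobolevFun_rep.const_smul c) h j).trans (Filter.Eventually.of_forall fun t => ?_)
    exact iteratedDerivWithin_const_smul_field c u.rep

theorem derivative_zero (u : Sobolev k p a b) : derivative 0 u = u.toLp := by
  refine Lp.ext ((MemLp.coeFn_toLp
    (u.isSobolevFun_rep.memLp_iteratedDerivWithin hab.out 0)).trans ?_)
  simpa using u.coeFn_ae_eq_rep.symm

/-- The derivatives of a class may be computed from any representative of class `W^k_p`. -/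
theorem derivative_ae_eq (u : Sobolev k p a b) {y : ℝ → ℂ} (hy : IsSobolevFun k p a b y)
    (h : u =ᵐ[intervalMeasure a b] y) (j : Fin (k + 1)) :
    derivative j u =ᵐ[intervalMeasure a b] iteratedDerivWithin j y (Icc a b) :=
  (MemLp.coeFn_toLp (u.isSobolevFun_rep.memLp_iteratedDerivWithin hab.out j)).trans
    (iteratedDerivWithin_ae_congr hab.out u.isSobolevFun_rep hy
    (u.coeFn_ae_eq_rep.symm.trans h) j)

/-- The norm of `W^k_p`: the sum of the `L_p` norms of the derivatives of orders `0, …, k`. -/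
instance : Norm (Sobolev k p a b) := ⟨fun u => ∑ j : Fin (k + 1), ‖derivative j u‖⟩

theorem norm_def (u : Sobolev k p a b) : ‖u‖ = ∑ j : Fin (k + 1), ‖derivative j u‖ := rfl

variable [hp : Fact (1 ≤ p)]

theorem normCore : NormedSpace.Core ℂ (Sobolev k p a b) where
  norm_nonneg u := Finset.sum_nonneg fun _ _ => norm_nonneg _
  norm_smul c u := by simp only [norm_def, map_smul, norm_smul, Finset.mul_sum]
  norm_triangle u v := by
    simp only [norm_def, map_add, ← Finset.sum_add_distrib]
    exact Finset.sum_le_sum fun _ _ => norm_add_le _ _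
  norm_eq_zero_iff u := by
    constructor
    · intro h
      have h0 : ‖derivative 0 u‖ = 0 :=
        (Finset.sum_eq_zero_iff_of_nonneg fun _ _ => norm_nonneg _).1 h 0 (Finset.mem_univ _)
      rw [norm_eq_zero, derivative_zero] at h0
      exact Subtype.ext h0
    · rintro rfl
      simp [norm_def]

instance : NormedAddCommGroup (Sobolev k p a b) := NormedAddCommGroup.ofCore normCore

instance : NormedSpace ℂ (Sobolev k p a b) := NormedSpace.ofCore normCore

end Sobolev

/-- The space `(W^k_p)^m` of `ℂ^m`-valued functions with components in `W^k_p`, normed by the sum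
of the norms of the components. -/
abbrev SobolevVec (m k : ℕ) (p : ENNReal) (a b : ℝ) [Fact (a < b)] : Type :=
  PiLp 1 (fun _ : Fin m => Sobolev k p a b)

/-- The `i`-th component, at `t`, of the differential expression
`L y = y^(r) + A_{r-1} y^(r-1) + ⋯ + A_0 y`, where `y ∈ (W^(n+r)_p)^m` and the entries of the
`m × m` matrix-valued coefficients `A_0, …, A_{r-1}` lie in `W^n_p`. -/
def diffExpr {m n r : ℕ} {p : ENNReal} {a b : ℝ} [Fact (a < b)]
    (A : Fin r → Matrix (Fin m) (Fin m) (Sobolev n p a b))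
    (y : SobolevVec m (n + r) p a b) (i : Fin m) (t : ℝ) : ℂ :=
  Sobolev.derivative ⟨r, by omega⟩ (y i) t +
    ∑ j : Fin r, ∑ q : Fin m, A j i q t * Sobolev.derivative ⟨j, by omega⟩ (y q) t

end SobolevBVP

end

set_option autoImplicit false
set_option linter.unusedSectionVars false
set_option linter.unusedVariables false

noncomputable section

namespace SobolevBVP

/-! ### Calculus of absolutely continuous functions -/

section AbsolutelyContinuous

variable {a b : ℝ} {E : Type*} [NormedAddCommGroup E] [NormedSpace ℝ E]

/-! Integration from `a`, `(f, c) ↦ c + ∫_a f`, identifies `W^k_p × ℂ` with `W^(k+1)_p`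
(`Sobolev.integrate`). Iterating it `r` times encodes `y ∈ W^(n+r)_p` by `z = y^(r) ∈ W^n_p` and the
`r` initial values of `y` at `a`.

For zero initial values, `L y = (1 + K) z` with `K z = ∑ⱼ Aⱼ J^(r-j) z`, where `J` is integration
from `a` (`toLp_diffOp_integrateIterVec`). Since `|K z|(t) ≤ α(t) ∫_a^t |z|` with `α` integrable,
the powers of `K` decay like `β^k / k!`, so `1 + K` is invertible on `L_p` vector functions
(`isUnit_one_add_volterra`). A solution with data in `W^n_p` is itself in `W^n_p`: in `z = f - K z`
each integration gains a derivative, and multiplication by the coefficients keeps it because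
`W^(k+1)_p` is an algebra (`mul_mem_succ`, `mem_of_one_add_volterra_mem`). So the Cauchy problem
with zero initial data is uniquely solvable. Hence `L` is surjective and its kernel is parametrised
by the `rm` initial values.

The rest is algebra. As `L` is surjective, the kernel and cokernel of `(L, B)` are those of `B`
restricted to `ker L`, a map from dimension `rm` to dimension `l`; rank-nullity gives the index
(`finrank_ker_sub_finrank_coker_prod`). A bounded right inverse of `L` inverts `(L, B)` up to finite
rank, whence Fredholmness (`isFredholm_prod`). -/

theorem absolutelyContinuous_of_dist_le {X Y : Type*} [PseudoMetricSpace X] [PseudoMetricSpace Y]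
    {f : ℝ → X} {g : ℝ → Y} (hg : AbsolutelyContinuousOnInterval g a b)
    (h : ∀ x ∈ uIcc a b, ∀ y ∈ uIcc a b, dist (f x) (f y) ≤ dist (g x) (g y)) :
    AbsolutelyContinuousOnInterval f a b := by
  rw [absolutelyContinuousOnInterval_iff] at hg ⊢
  intro ε hε
  obtain ⟨δ, hδ, H⟩ := hg ε hε
  refine ⟨δ, hδ, fun E hE hlt => lt_of_le_of_lt ?_ (H E hE hlt)⟩
  exact Finset.sum_le_sum fun i hi => h _ (hE.1 i hi).1 _ (hE.1 i hi).2

theorem intervalIntegrable_of_mem {f : ℝ → E} (h : IntervalIntegrable f volume a b) {x y : ℝ}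
    (hx : x ∈ uIcc a b) (hy : y ∈ uIcc a b) : IntervalIntegrable f volume x y :=
  h.mono_set (uIcc_subset_uIcc hx hy)

theorem absolutelyContinuous_integral {f : ℝ → E} (h : IntervalIntegrable f volume a b) :
    AbsolutelyContinuousOnInterval (fun x => ∫ t in a..x, f t) a b := by
  refine absolutelyContinuous_of_dist_le
    (h.norm.absolutelyContinuousOnInterval_intervalIntegral (c := a) left_mem_uIcc) ?_
  intro x hx y hy
  have hax := intervalIntegrable_of_mem h left_mem_uIcc hx
  have hay := intervalIntegrable_of_mem h left_mem_uIcc hy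
  rw [dist_eq_norm, dist_eq_norm, intervalIntegral.integral_interval_sub_left hax hay,
    intervalIntegral.integral_interval_sub_left hax.norm hay.norm]
  exact intervalIntegral.norm_integral_le_abs_integral_norm

theorem absolutelyContinuous_const_add_integral (c : E) {f : ℝ → E}
    (h : IntervalIntegrable f volume a b) :
    AbsolutelyContinuousOnInterval (fun x => c + ∫ t in a..x, f t) a b := by
  refine absolutelyContinuous_of_dist_le (absolutelyContinuous_integral h) ?_
  intro x _ y _
  simp

theorem ae_hasDerivAt_const_add_integral [CompleteSpace E] (c : E) {f : ℝ → E}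
    (h : IntervalIntegrable f volume a b) :
    ∀ᵐ x, x ∈ uIcc a b → HasDerivAt (fun x => c + ∫ t in a..x, f t) (f x) x := by
  filter_upwards [h.ae_hasDerivAt_integral] with x hx hmem
  exact (hx hmem a left_mem_uIcc).const_add c

/-- Subtracting the primitive of `g` leaves an absolutely continuous function with derivative zero
almost everywhere, hence a constant. -/
theorem eq_add_integral_of_ae_hasDerivAt [CompleteSpace E] {f g : ℝ → E}
    (hf : AbsolutelyContinuousOnInterval f a b) (hg : IntervalIntegrable g volume a b)
    (h : ∀ᵐ x, x ∈ uIcc a b → HasDerivAt f (g x) x) {x : ℝ} (hx : x ∈ uIcc a b) :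
    f x = f a + ∫ t in a..x, g t := by
  have h0 : ∀ᵐ x, x ∈ uIcc a b → HasDerivAt (f - fun x => ∫ t in a..x, g t) 0 x := by
    filter_upwards [h, hg.ae_hasDerivAt_integral] with x h1 h2 hmem
    simpa using (h1 hmem).sub (h2 hmem a left_mem_uIcc)
  obtain ⟨C, hC⟩ :=
    (hf.sub (absolutelyContinuous_integral hg)).const_of_ae_hasDerivAt_zero h0
  have h1 := hC x hx
  have h2 := hC a left_mem_uIcc
  simp only [Pi.sub_apply, intervalIntegral.integral_same, sub_zero] at h1 h2
  rw [h2, ← h1, sub_add_cancel]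

/-- The Leibniz rule in integrated form; it is what makes the Sobolev spaces of positive order
algebras. -/
theorem const_add_integral_mul {f g : ℝ → ℂ} (hf : IntervalIntegrable f volume a b)
    (hg : IntervalIntegrable g volume a b) (c d : ℂ) {x : ℝ} (hx : x ∈ uIcc a b) :
    (c + ∫ t in a..x, f t) * (d + ∫ t in a..x, g t) =
      c * d + ∫ t in a..x, (f t * (d + ∫ s in a..t, g s) + (c + ∫ s in a..t, f s) * g t) := by
  have hF := absolutelyContinuous_const_add_integral c hf
  have hG := absolutelyContinuous_const_add_integral d hg
  have key := eq_add_integral_of_ae_hasDerivAt (hF.fun_smul hG)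
    ((hf.mul_continuousOn hG.continuousOn).add (hg.continuousOn_mul hF.continuousOn)) ?_ hx
  · simpa using key
  · filter_upwards [ae_hasDerivAt_const_add_integral c hf,
      ae_hasDerivAt_const_add_integral d hg] with x h1 h2 hmem
    exact (h1 hmem).mul (h2 hmem)

end AbsolutelyContinuous

/-! ### Recursion in the order: `y ∈ W^(k+1)_p` exactly when `y = c + ∫_a f` with `f ∈ W^k_p` -/

section Recursion

variable {k : ℕ} {p : ENNReal} {a b : ℝ}

theorem intervalIntegrable_of_memLp (hp : 1 ≤ p) (hab : a < b) {f : ℝ → ℂ}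
    (hf : MemLp f p (intervalMeasure a b)) : IntervalIntegrable f volume a b :=
  (intervalIntegrable_iff_integrableOn_Icc_of_le hab.le).2 (hf.integrable hp)

theorem ae_mem_Ioo (a b : ℝ) : ∀ᵐ t ∂(intervalMeasure a b), t ∈ Ioo a b := by
  rw [intervalMeasure, ← restrict_Ioo_eq_restrict_Icc]
  exact ae_restrict_mem measurableSet_Ioo

theorem ae_hasDerivAt_derivWithin (hab : a < b) {y : ℝ → ℂ}
    (hy : AbsolutelyContinuousOnInterval y a b) :
    ∀ᵐ t ∂(intervalMeasure a b), HasDerivAt y (derivWithin y (Icc a b) t) t := by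
  filter_upwards [ae_differentiableWithinAt_of_absolutelyContinuous hab hy, ae_mem_Ioo a b]
    with t h1 h2
  exact h1.hasDerivWithinAt.hasDerivAt (Icc_mem_nhds h2.1 h2.2)

theorem ae_imp_of_ae_intervalMeasure (hab : a < b) {P : ℝ → Prop}
    (h : ∀ᵐ t ∂(intervalMeasure a b), P t) : ∀ᵐ t, t ∈ uIcc a b → P t := by
  rw [uIcc_of_le hab.le]
  exact (ae_restrict_iff' measurableSet_Icc).1 h

theorem ae_intervalMeasure_of_ae_imp (hab : a < b) {P : ℝ → Prop}
    (h : ∀ᵐ t, t ∈ uIcc a b → P t) : ∀ᵐ t ∂(intervalMeasure a b), P t := by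
  rw [uIcc_of_le hab.le] at h
  exact (ae_restrict_iff' measurableSet_Icc).2 h

theorem IsSobolevFun.absolutelyContinuous (hab : a < b) {y : ℝ → ℂ}
    (hy : IsSobolevFun (k + 1) p a b y) : AbsolutelyContinuousOnInterval y a b := by
  cases k with
  | zero => simpa using hy.2.1
  | succ k =>
    refine ContDiffOn.absolutelyContinuousOnInterval ?_
    rw [uIcc_of_le hab.le]
    exact hy.1.of_le (by exact_mod_cast Nat.le_add_left 1 k)

theorem IsSobolevFun.derivWithin (hab : a < b) {y : ℝ → ℂ}
    (hy : IsSobolevFun (k + 1) p a b y) :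
    IsSobolevFun k p a b (derivWithin y (Icc a b)) := by
  cases k with
  | zero =>
    have := hy.2.2
    rw [iteratedDerivWithin_succ'] at this
    simpa [IsSobolevFun] using this
  | succ k =>
    obtain ⟨h1, h2, h3⟩ := hy
    rw [iteratedDerivWithin_succ'] at h2 h3
    refine ⟨?_, h2, h3⟩
    push_cast at h1
    exact ((contDiffOn_succ_iff_derivWithin (uniqueDiffOn_Icc hab)).1 h1).2.2

theorem IsSobolevFun.eq_add_integral (hp : 1 ≤ p) (hab : a < b) {y : ℝ → ℂ}
    (hy : IsSobolevFun (k + 1) p a b y) {t : ℝ} (ht : t ∈ Icc a b) :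
    y t = y a + ∫ s in a..t, _root_.derivWithin y (Icc a b) s := by
  have hm : MemLp (_root_.derivWithin y (Icc a b)) p (intervalMeasure a b) := by
    simpa [iteratedDerivWithin_one] using
      hy.memLp_iteratedDerivWithin hab ⟨1, by omega⟩
  refine eq_add_integral_of_ae_hasDerivAt (hy.absolutelyContinuous hab)
    (intervalIntegrable_of_memLp hp hab hm)
    (ae_imp_of_ae_intervalMeasure hab
      (ae_hasDerivAt_derivWithin hab (hy.absolutelyContinuous hab))) ?_
  rwa [uIcc_of_le hab.le]

theorem IsSobolevFun.memLp (hab : a < b) {y : ℝ → ℂ} (hy : IsSobolevFun k p a b y) :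
    MemLp y p (intervalMeasure a b) := by
  simpa using hy.memLp_iteratedDerivWithin hab 0

theorem derivWithin_primitive_ae (hab : a < b) {f y : ℝ → ℂ} {c : ℂ}
    (hf : IntervalIntegrable f volume a b)
    (hy : ∀ t ∈ Icc a b, y t = c + ∫ s in a..t, f s) :
    derivWithin y (Icc a b) =ᵐ[intervalMeasure a b] f := by
  filter_upwards [ae_intervalMeasure_of_ae_imp hab (ae_hasDerivAt_const_add_integral c hf),
    ae_restrict_mem measurableSet_Icc] with t h1 h2
  rw [derivWithin_congr hy (hy t h2)]
  exact h1.hasDerivWithinAt.derivWithin (uniqueDiffOn_Icc hab t h2)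

theorem hasDerivWithinAt_primitive (hab : a < b) {f y : ℝ → ℂ} {c : ℂ}
    (hf : ContinuousOn f (Icc a b))
    (hy : ∀ t ∈ Icc a b, y t = c + ∫ s in a..t, f s) {t : ℝ} (ht : t ∈ Icc a b) :
    HasDerivWithinAt y (f t) (Icc a b) t := by
  -- Extending `f` by its endpoint values makes it continuous on the whole line, so the fundamental
  -- theorem also covers the endpoints.
  set F : ℝ → ℂ := IccExtend hab.le ((Icc a b).domRestrict f) with hF
  have hFc : Continuous F := by
    rw [hF]
    exact hf.domRestrict.Icc_extend'
  have hFe : ∀ s ∈ Icc a b, F s = f s := fun s hs => by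
    rw [hF, IccExtend_of_mem _ _ hs]; rfl
  have hd : HasDerivAt (fun t => c + ∫ s in a..t, F s) (F t) t :=
    (hFc.integral_hasStrictDerivAt a t).hasDerivAt.const_add c
  rw [← hFe t ht]
  refine hd.hasDerivWithinAt.congr_of_mem (fun x hx => ?_) ht
  rw [hy x hx]
  congr 1
  refine intervalIntegral.integral_congr fun s hs => (hFe s ?_).symm
  rw [uIcc_of_le hx.1] at hs
  exact ⟨hs.1, hs.2.trans hx.2⟩

theorem IsSobolevFun.primitive (hp : 1 ≤ p) (hab : a < b) {f y : ℝ → ℂ} {c : ℂ}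
    (hf : IsSobolevFun k p a b f) (hy : ∀ t ∈ Icc a b, y t = c + ∫ s in a..t, f s) :
    IsSobolevFun (k + 1) p a b y := by
  have hfi := intervalIntegrable_of_memLp hp hab (hf.memLp hab)
  have hyAC : AbsolutelyContinuousOnInterval y a b :=
    absolutelyContinuous_congr hab (fun t ht => (hy t ht).symm)
      (absolutelyContinuous_const_add_integral c hfi)
  cases k with
  | zero =>
    refine ⟨?_, by simpa using hyAC, ?_⟩
    · have := hyAC.continuousOn
      rw [uIcc_of_le hab.le] at this
      simpa using this
    · have e : iteratedDerivWithin (0 + 1) y (Icc a b) = _root_.derivWithin y (Icc a b) :=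
        iteratedDerivWithin_one
      rw [e]
      exact (memLp_congr_ae (derivWithin_primitive_ae hab hfi hy)).2 hf
  | succ k =>
    obtain ⟨h1, h2, h3⟩ := hf
    have hd : ∀ t ∈ Icc a b, HasDerivWithinAt y (f t) (Icc a b) t := fun t ht =>
      hasDerivWithinAt_primitive hab h1.continuousOn hy ht
    have hE : EqOn (_root_.derivWithin y (Icc a b)) f (Icc a b) := fun t ht =>
      (hd t ht).derivWithin (uniqueDiffOn_Icc hab t ht)
    have hiter (j : ℕ) : EqOn (iteratedDerivWithin (j + 1) y (Icc a b))
        (iteratedDerivWithin j f (Icc a b)) (Icc a b) := fun t ht => by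
      rw [iteratedDerivWithin_succ']
      exact iteratedDerivWithin_congr hE ht
    refine ⟨?_, absolutelyContinuous_congr hab (hiter k).symm h2, ?_⟩
    · push_cast
      refine (contDiffOn_succ_iff_derivWithin (uniqueDiffOn_Icc hab)).2
        ⟨fun t ht => (hd t ht).differentiableWithinAt, by simp, h1.congr hE⟩
    · refine (memLp_congr_ae ?_).2 h3
      filter_upwards [ae_restrict_mem measurableSet_Icc] with t ht using hiter (k + 1) ht

end Recursion

/-! ### The integration isomorphism `W^k_p × ℂ ≃ W^(k+1)_p` and completeness -/

section Primitive

variable {k : ℕ} {p : ENNReal} {a b : ℝ} [hab : Fact (a < b)] [hp : Fact (1 ≤ p)]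

theorem integral_congr_of_ae_eq {E : Type*} [NormedAddCommGroup E] [NormedSpace ℝ E]
    {f g : ℝ → E} (h : f =ᵐ[intervalMeasure a b] g) {t : ℝ}
    (ht : t ∈ Icc a b) : ∫ s in a..t, f s = ∫ s in a..t, g s := by
  refine intervalIntegral.integral_congr_ae ?_
  filter_upwards [(ae_restrict_iff' measurableSet_Icc).1 h] with s hs hmem
  rw [uIoc_of_le ht.1] at hmem
  exact hs ⟨hmem.1.le, hmem.2.trans ht.2⟩

theorem intervalIntegrable_coeFn (f : Lp ℂ p (intervalMeasure a b)) :
    IntervalIntegrable f volume a b :=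
  intervalIntegrable_of_memLp hp.out hab.out (Lp.memLp f)

theorem intervalIntegrable_coeFn_of_mem (f : Lp ℂ p (intervalMeasure a b)) {t : ℝ}
    (ht : t ∈ Icc a b) : IntervalIntegrable f volume a t :=
  intervalIntegrable_of_mem (intervalIntegrable_coeFn f) left_mem_uIcc
    (by rwa [uIcc_of_le hab.out.le])

theorem exists_integral_norm_le (p : ENNReal) (a b : ℝ) [hab : Fact (a < b)]
    [hp : Fact (1 ≤ p)] : ∃ C : ℝ, 0 ≤ C ∧
      ∀ f : Lp ℂ p (intervalMeasure a b), ∫ t in a..b, ‖f t‖ ≤ C * ‖f‖ := by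
  -- Hölder's constant `μ^(1 - 1/p)` on a space of finite measure. For `p = ⊤` the convention `1 / 0
  -- = 0` gives the correct exponent `1`.
  set M := intervalMeasure a b univ ^ (1 / (1 : ENNReal).toReal - 1 / p.toReal) with hM
  have hMtop : M ≠ ⊤ := by
    refine ENNReal.rpow_ne_top_of_nonneg ?_ (measure_ne_top _ _)
    rcases eq_or_ne p ⊤ with rfl | hp'
    · simp
    · have : 1 ≤ p.toReal := by
        simpa using (ENNReal.toReal_le_toReal ENNReal.one_ne_top hp').2 hp.out
      simpa using inv_le_one_of_one_le₀ this
  refine ⟨M.toReal, ENNReal.toReal_nonneg, fun f => ?_⟩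
  have hf := Lp.aestronglyMeasurable f
  have h := eLpNorm_le_eLpNorm_mul_rpow_measure_univ hp.out hf
  rw [intervalIntegral.integral_of_le hab.out.le, ← integral_Icc_eq_integral_Ioc,
    integral_norm_eq_lintegral_enorm hf, ← eLpNorm_one_eq_lintegral_enorm, Lp.norm_def,
    ← ENNReal.toReal_mul, mul_comm]
  exact ENNReal.toReal_mono (ENNReal.mul_ne_top (Lp.eLpNorm_ne_top f) hMtop) h

theorem integral_norm_le_integral_norm (f : Lp ℂ p (intervalMeasure a b)) {t : ℝ}
    (ht : t ∈ Icc a b) : ∫ s in a..t, ‖f s‖ ≤ ∫ s in a..b, ‖f s‖ :=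
  intervalIntegral.integral_mono_interval le_rfl ht.1 ht.2
    (Filter.Eventually.of_forall fun _ => norm_nonneg _) (intervalIntegrable_coeFn f).norm

theorem norm_integral_le_integral_norm (f : Lp ℂ p (intervalMeasure a b)) {t : ℝ}
    (ht : t ∈ Icc a b) : ‖∫ s in a..t, f s‖ ≤ ∫ s in a..b, ‖f s‖ :=
  (intervalIntegral.norm_integral_le_integral_norm ht.1).trans
    (integral_norm_le_integral_norm f ht)

theorem continuousOn_integral (f : Lp ℂ p (intervalMeasure a b)) :
    ContinuousOn (fun t => ∫ s in a..t, f s) (Icc a b) := by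
  have := (absolutelyContinuous_integral (intervalIntegrable_coeFn f)).continuousOn
  rwa [uIcc_of_le hab.out.le] at this

theorem memLp_integral (q : ENNReal) (f : Lp ℂ p (intervalMeasure a b)) :
    MemLp (fun t => ∫ s in a..t, f s) q (intervalMeasure a b) :=
  MemLp.of_bound ((continuousOn_integral f).aestronglyMeasurable measurableSet_Icc)
    (∫ s in a..b, ‖f s‖) ((ae_restrict_iff' measurableSet_Icc).2
      (Filter.Eventually.of_forall fun _ ht => norm_integral_le_integral_norm f ht))

/-- The primitive vanishing at `a` of an `L_p` function, as an element of `L_q`. -/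
def primitiveₗ (q : ENNReal) :
    Lp ℂ p (intervalMeasure a b) →ₗ[ℂ] Lp ℂ q (intervalMeasure a b) where
  toFun f := (memLp_integral q f).toLp _
  map_add' f g := by
    rw [← MemLp.toLp_add]
    refine MemLp.toLp_congr _ _ ?_
    filter_upwards [ae_restrict_mem measurableSet_Icc] with t ht
    rw [Pi.add_apply, ← intervalIntegral.integral_add (intervalIntegrable_coeFn_of_mem f ht)
      (intervalIntegrable_coeFn_of_mem g ht)]
    exact integral_congr_of_ae_eq (Lp.coeFn_add f g) ht
  map_smul' c f := by
    rw [RingHom.id_apply, ← MemLp.toLp_const_smul]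
    refine MemLp.toLp_congr _ _ ?_
    filter_upwards [ae_restrict_mem measurableSet_Icc] with t ht
    rw [Pi.smul_apply, ← intervalIntegral.integral_smul]
    exact integral_congr_of_ae_eq (Lp.coeFn_smul c f) ht

theorem coeFn_primitiveₗ (q : ENNReal) (f : Lp ℂ p (intervalMeasure a b)) :
    primitiveₗ q f =ᵐ[intervalMeasure a b] fun t => ∫ s in a..t, f s :=
  (memLp_integral q f).coeFn_toLp

/-- A primitive is bounded pointwise by the `L_1` norm of `f`, so any target exponent `q` is
allowed. The case `q = p` permits iteration; `q = ⊤` permits multiplication by a coefficient that is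
merely in `L_p`. -/
theorem exists_norm_primitiveₗ_le (p q : ENNReal) (a b : ℝ) [hab : Fact (a < b)]
    [hp : Fact (1 ≤ p)] : ∃ C : ℝ,
      ∀ f : Lp ℂ p (intervalMeasure a b), ‖primitiveₗ q f‖ ≤ C * ‖f‖ := by
  obtain ⟨C, hC, h⟩ := exists_integral_norm_le p a b
  refine ⟨(measureUnivNNReal (intervalMeasure a b) : ℝ) ^ q.toReal⁻¹ * C, fun f => ?_⟩
  rw [mul_assoc]
  refine Lp.norm_le_of_ae_bound (by positivity) ?_
  filter_upwards [coeFn_primitiveₗ q f, ae_restrict_mem measurableSet_Icc] with t h1 ht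
  rw [h1]
  exact (norm_integral_le_integral_norm f ht).trans (h f)

/-- The primitive vanishing at `a`, as a bounded operator from `L_p` to `L_q`. -/
def primitive (q : ENNReal) [Fact (1 ≤ q)] :
    Lp ℂ p (intervalMeasure a b) →L[ℂ] Lp ℂ q (intervalMeasure a b) :=
  ⟨primitiveₗ q, by
    obtain ⟨C, hC⟩ := exists_norm_primitiveₗ_le p q a b
    exact AddMonoidHomClass.continuous_of_bound _ C hC⟩

theorem coeFn_primitive (q : ENNReal) [Fact (1 ≤ q)] (f : Lp ℂ p (intervalMeasure a b)) :
    primitive q f =ᵐ[intervalMeasure a b] fun t => ∫ s in a..t, f s :=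
  coeFn_primitiveₗ q f

theorem coeFn_primitive_add_const (f : Lp ℂ p (intervalMeasure a b)) (c : ℂ) :
    (primitive p f + Lp.constL p (intervalMeasure a b) ℂ c : Lp ℂ p (intervalMeasure a b))
      =ᵐ[intervalMeasure a b] fun t => c + ∫ s in a..t, f s := by
  filter_upwards [Lp.coeFn_add (primitive p f) (Lp.constL p (intervalMeasure a b) ℂ c),
    coeFn_primitive p f, Lp.coeFn_const p (intervalMeasure a b) c] with t h1 h2 h3
  rw [h1, Pi.add_apply, h2, Lp.constL_apply, h3, Function.const_apply, add_comm]

/-- A continuous function vanishing almost everywhere on `[a, b]` vanishes there; its value at `a`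
is `c` and its derivative is `f`. This is injectivity of the integration map. -/
theorem eq_zero_of_primitive_add_const {f : Lp ℂ p (intervalMeasure a b)} {c : ℂ}
    (h : primitive p f + Lp.constL p (intervalMeasure a b) ℂ c = 0) : f = 0 ∧ c = 0 := by
  have hi := intervalIntegrable_coeFn f
  have h0 : (fun t => c + ∫ s in a..t, f s) =ᵐ[intervalMeasure a b] 0 := by
    refine (coeFn_primitive_add_const f c).symm.trans ?_
    rw [h]
    exact Lp.coeFn_zero _ _ _
  have hE : EqOn (fun t => c + ∫ s in a..t, f s) 0 (Icc a b) :=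
    Measure.eqOn_Icc_of_ae_eq volume hab.out.ne h0
      (continuousOn_const.add (continuousOn_integral f)) continuousOn_const
  refine ⟨?_, by simpa using hE (left_mem_Icc.2 hab.out.le)⟩
  refine Lp.ext (((derivWithin_primitive_ae (y := 0) hab.out hi
    (fun t ht => (hE ht).symm)).symm.trans ?_).trans (Lp.coeFn_zero _ _ _).symm)
  filter_upwards with t
  simp

theorem mem_sobolevSubmodule_zero (v : Lp ℂ p (intervalMeasure a b)) :
    v ∈ sobolevSubmodule 0 p a b :=
  ⟨v, Lp.memLp v, Filter.EventuallyEq.rfl⟩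

theorem primitive_add_const_mem {f : Lp ℂ p (intervalMeasure a b)}
    (hf : f ∈ sobolevSubmodule k p a b) (c : ℂ) :
    primitive p f + Lp.constL p (intervalMeasure a b) ℂ c ∈ sobolevSubmodule (k + 1) p a b := by
  obtain ⟨y, hy, hfy⟩ := hf
  refine ⟨fun t => c + ∫ s in a..t, f s, ?_, coeFn_primitive_add_const f c⟩
  refine hy.primitive hp.out hab.out (c := c) fun t ht => ?_
  rw [integral_congr_of_ae_eq hfy ht]

theorem primitive_mem {f : Lp ℂ p (intervalMeasure a b)}
    (hf : f ∈ sobolevSubmodule k p a b) : primitive p f ∈ sobolevSubmodule (k + 1) p a b := by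
  simpa using primitive_add_const_mem hf 0

theorem exists_eq_primitive_add_const {v : Lp ℂ p (intervalMeasure a b)}
    (hv : v ∈ sobolevSubmodule (k + 1) p a b) : ∃ f ∈ sobolevSubmodule k p a b, ∃ c : ℂ,
      v = primitive p f + Lp.constL p (intervalMeasure a b) ℂ c := by
  obtain ⟨y, hy, hvy⟩ := hv
  have hd := (hy.derivWithin hab.out).memLp hab.out
  refine ⟨hd.toLp _, ⟨_, hy.derivWithin hab.out, hd.coeFn_toLp⟩, y a, Lp.ext ?_⟩
  refine hvy.trans (Filter.EventuallyEq.trans ?_ (coeFn_primitive_add_const _ _).symm)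
  filter_upwards [ae_restrict_mem measurableSet_Icc] with t ht
  rw [hy.eq_add_integral hp.out hab.out ht, integral_congr_of_ae_eq hd.coeFn_toLp ht]

theorem sobolevSubmodule_succ_le (k : ℕ) :
    sobolevSubmodule (k + 1) p a b ≤ sobolevSubmodule k p a b := by
  induction k with
  | zero => exact fun v _ => mem_sobolevSubmodule_zero v
  | succ k ih =>
    intro v hv
    obtain ⟨f, hf, c, rfl⟩ := exists_eq_primitive_add_const hv
    exact primitive_add_const_mem (ih hf) c

theorem sobolevSubmodule_anti : Antitone fun k => sobolevSubmodule k p a b :=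
  antitone_nat_of_succ_le sobolevSubmodule_succ_le

namespace Sobolev

/-- The derivative of order `j` as a bounded operator into `L_p`. -/
def derivativeL (j : Fin (k + 1)) : Sobolev k p a b →L[ℂ] Lp ℂ p (intervalMeasure a b) :=
  (derivative j).mkContinuous 1 fun u => by
    rw [one_mul, norm_def]
    exact Finset.single_le_sum (f := fun j => ‖derivative j u‖) (fun _ _ => norm_nonneg _)
      (Finset.mem_univ j)

@[simp]
theorem derivativeL_apply (j : Fin (k + 1)) (u : Sobolev k p a b) :
    derivativeL j u = derivative j u := rfl

/-- The inclusion of `W^k_p` into `L_p`. -/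
def toLpL : Sobolev k p a b →L[ℂ] Lp ℂ p (intervalMeasure a b) := derivativeL 0

@[simp]
theorem toLpL_apply (u : Sobolev k p a b) : toLpL u = u.toLp := derivative_zero u

theorem toLp_injective : Function.Injective (toLp : Sobolev k p a b → _) :=
  Subtype.val_injective

theorem toLp_mem (u : Sobolev k p a b) : u.toLp ∈ sobolevSubmodule k p a b :=
  Subtype.property (p := (· ∈ sobolevSubmodule k p a b)) u

/-- The integration map `(f, c) ↦ c + ∫_a f`. -/
def integrateₗ : (Sobolev k p a b × ℂ) →ₗ[ℂ] Sobolev (k + 1) p a b :=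
  LinearMap.codRestrict (sobolevSubmodule (k + 1) p a b)
    (((primitive p : _ →L[ℂ] Lp ℂ p (intervalMeasure a b)).comp toLpL).coprod
      (Lp.constL p (intervalMeasure a b) ℂ)).toLinearMap
    (fun x => by simpa using primitive_add_const_mem x.1.toLp_mem x.2)

theorem toLp_integrateₗ (x : Sobolev k p a b × ℂ) :
    (integrateₗ x).toLp = primitive p x.1.toLp + Lp.constL p (intervalMeasure a b) ℂ x.2 := by
  change primitive p (toLpL x.1) + _ = _
  simp

theorem integrateₗ_bijective :
    Function.Bijective (integrateₗ : (Sobolev k p a b × ℂ) →ₗ[ℂ] Sobolev (k + 1) p a b) := by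
  constructor
  · rw [← LinearMap.ker_eq_bot, LinearMap.ker_eq_bot']
    intro x hx
    have := congrArg toLp hx
    rw [toLp_integrateₗ] at this
    obtain ⟨h1, h2⟩ := eq_zero_of_primitive_add_const this
    exact Prod.ext (toLp_injective h1) h2
  · intro u
    obtain ⟨f, hf, c, h⟩ := exists_eq_primitive_add_const u.toLp_mem
    exact ⟨(⟨f, hf⟩, c), toLp_injective ((toLp_integrateₗ _).trans h.symm)⟩

theorem derivative_succ_integrateₗ (x : Sobolev k p a b × ℂ) (j : Fin (k + 1)) :
    derivative j.succ (integrateₗ x) = derivative j x.1 := by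
  have hf := x.1.isSobolevFun_rep
  have hi := intervalIntegrable_coeFn x.1.toLp
  set y : ℝ → ℂ := fun t => x.2 + ∫ s in a..t, x.1.toLp s with hy
  have hys : IsSobolevFun (k + 1) p a b y :=
    hf.primitive hp.out hab.out (c := x.2) fun t ht => by
      rw [hy, ← integral_congr_of_ae_eq x.1.coeFn_ae_eq_rep ht]
  have hyu : integrateₗ x =ᵐ[intervalMeasure a b] y := by
    rw [toLp_integrateₗ]
    exact coeFn_primitive_add_const _ _
  refine Lp.ext ((derivative_ae_eq _ hys hyu j.succ).trans ?_)
  rw [Fin.val_succ, iteratedDerivWithin_succ']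
  refine (derivative_ae_eq x.1 (hys.derivWithin hab.out) ?_ j).symm
  exact (derivWithin_primitive_ae hab.out hi fun t _ => rfl).symm

/-- Derivatives of positive order do not see the constant and reproduce the norm of `f`; only the
order-zero term is new. Both continuity bounds for `integrate` come from this identity. -/
theorem norm_integrateₗ (x : Sobolev k p a b × ℂ) :
    ‖integrateₗ x‖ =
      ‖primitive p x.1.toLp + Lp.constL p (intervalMeasure a b) ℂ x.2‖ + ‖x.1‖ := by
  rw [norm_def, Fin.sum_univ_succ, derivative_zero, toLp_integrateₗ, norm_def]
  simp only [derivative_succ_integrateₗ]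

theorem norm_toLp_le (u : Sobolev k p a b) : ‖u.toLp‖ ≤ ‖u‖ := by
  rw [← derivative_zero, norm_def]
  exact Finset.single_le_sum (f := fun j => ‖derivative j u‖) (fun _ _ => norm_nonneg _)
    (Finset.mem_univ 0)

instance : NeZero (intervalMeasure a b) :=
  ⟨by
    rw [intervalMeasure, Ne, Measure.restrict_eq_zero, Real.volume_Icc]
    simpa using hab.out⟩

theorem exists_norm_le_norm_constL (p : ENNReal) (a b : ℝ) [hab : Fact (a < b)]
    [hp : Fact (1 ≤ p)] : ∃ κ : ℝ, 0 ≤ κ ∧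
      ∀ c : ℂ, ‖c‖ ≤ κ * ‖Lp.constL p (intervalMeasure a b) ℂ c‖ := by
  set M := (intervalMeasure a b).real univ ^ (1 / p.toReal) with hM
  have hpos : 0 < M := by
    refine Real.rpow_pos_of_pos ?_ _
    rw [measureReal_def]
    exact ENNReal.toReal_pos (NeZero.ne _) (measure_ne_top _ _)
  refine ⟨M⁻¹, by positivity, fun c => ?_⟩
  rw [Lp.constL_apply, Lp.norm_const _ _ _ (zero_lt_one.trans_le hp.out).ne', ← hM]
  field_simp
  exact le_rfl

/-- The isomorphism `W^k_p × ℂ ≃ W^(k+1)_p`, `(f, c) ↦ c + ∫_a f`. -/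
def integrate : (Sobolev k p a b × ℂ) ≃L[ℂ] Sobolev (k + 1) p a b :=
  ContinuousLinearEquiv.mk (LinearEquiv.ofBijective integrateₗ integrateₗ_bijective)
    (by
      refine AddMonoidHomClass.continuous_of_bound
        (integrateₗ : (Sobolev k p a b × ℂ) →ₗ[ℂ] Sobolev (k + 1) p a b)
        (‖(primitive p : Lp ℂ p (intervalMeasure a b) →L[ℂ] Lp ℂ p (intervalMeasure a b))‖ +
          ‖(Lp.constL p (intervalMeasure a b) ℂ : ℂ →L[ℂ] _)‖ + 1) fun x => ?_
      rw [norm_integrateₗ, add_mul, add_mul, one_mul]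
      refine add_le_add ((norm_add_le _ _).trans (add_le_add ?_ ?_)) (norm_fst_le x)
      · refine (ContinuousLinearMap.le_opNorm _ _).trans ?_
        gcongr
        exact (norm_toLp_le _).trans (norm_fst_le x)
      · refine (ContinuousLinearMap.le_opNorm _ _).trans ?_
        gcongr
        exact norm_snd_le x)
    (by
      obtain ⟨κ, hκ, hc⟩ := exists_norm_le_norm_constL p a b
      set P := ‖(primitive p : Lp ℂ p (intervalMeasure a b) →L[ℂ] Lp ℂ p (intervalMeasure a b))‖
      refine AddMonoidHomClass.continuous_of_bound
        (LinearEquiv.ofBijective integrateₗ integrateₗ_bijective).symm.toLinearMap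
        (max 1 (κ * (1 + P))) fun u => ?_
      obtain ⟨x, rfl⟩ := (LinearEquiv.ofBijective _ (integrateₗ_bijective (k := k) (p := p)
        (a := a) (b := b))).surjective u
      rw [LinearEquiv.coe_coe, LinearEquiv.symm_apply_apply, LinearEquiv.ofBijective_apply]
      have h1 : ‖x.1‖ ≤ ‖integrateₗ x‖ := by
        rw [norm_integrateₗ]
        exact le_add_of_nonneg_left (norm_nonneg _)
      -- The constant is recovered as the whole function minus its primitive part, both controlled
      -- in `L_p`.
      have h2 : ‖x.2‖ ≤ κ * (1 + P) * ‖integrateₗ x‖ := by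
        refine (hc _).trans ?_
        rw [mul_assoc]
        gcongr
        have h3 : ‖primitive p x.1.toLp‖ ≤ P * ‖integrateₗ x‖ :=
          (ContinuousLinearMap.le_opNorm _ _).trans
            (mul_le_mul_of_nonneg_left ((norm_toLp_le _).trans h1) (norm_nonneg _))
        have h4 : ‖primitive p x.1.toLp + Lp.constL p (intervalMeasure a b) ℂ x.2‖ ≤
            ‖integrateₗ x‖ := by
          rw [norm_integrateₗ]
          exact le_add_of_nonneg_right (norm_nonneg _)
        have h5 := norm_sub_le (primitive p x.1.toLp +
          Lp.constL p (intervalMeasure a b) ℂ x.2) (primitive p x.1.toLp)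
        rw [add_sub_cancel_left] at h5
        linarith
      rw [Prod.norm_def]
      refine max_le (h1.trans ?_) (h2.trans ?_)
      · exact le_mul_of_one_le_left (norm_nonneg _) (le_max_left _ _)
      · exact mul_le_mul_of_nonneg_right (le_max_right _ _) (norm_nonneg _))

theorem toLp_integrate (x : Sobolev k p a b × ℂ) :
    (integrate x).toLp = primitive p x.1.toLp + Lp.constL p (intervalMeasure a b) ℂ x.2 :=
  toLp_integrateₗ x

theorem derivative_succ_integrate (x : Sobolev k p a b × ℂ) (j : Fin (k + 1)) :
    derivative j.succ (integrate x) = derivative j x.1 :=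
  derivative_succ_integrateₗ x j

/-- `W^0_p` is `L_p`. -/
def zeroIsometry : Sobolev 0 p a b ≃ₗᵢ[ℂ] Lp ℂ p (intervalMeasure a b) where
  toLinearEquiv := LinearEquiv.ofBijective (toLpL (k := 0)).toLinearMap
    ⟨fun u v h => toLp_injective (by simpa using h),
      fun v => ⟨⟨v, mem_sobolevSubmodule_zero v⟩, toLpL_apply _⟩⟩
  norm_map' u := by
    rw [norm_def, Fin.sum_univ_one]
    exact congrArg norm ((toLpL_apply u).trans (derivative_zero u).symm)

/-- Completeness passes from `L_p` to every order along `integrate`. The closed graph and open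
mapping arguments below depend on it. -/
instance instCompleteSpace : CompleteSpace (Sobolev k p a b) := by
  induction k with
  | zero =>
    exact (completeSpace_congr (e := (zeroIsometry (p := p) (a := a) (b := b)).toEquiv)
      zeroIsometry.isometry.isUniformEmbedding).2
      inferInstance
  | succ k ih =>
    have e : (Sobolev k p a b × ℂ) ≃L[ℂ] Sobolev (k + 1) p a b := integrate
    exact (completeSpace_congr (e := e.toEquiv) e.isUniformEmbedding).1 inferInstance

end Sobolev

end Primitive

/-! ### Products in Sobolev spaces and the bounded operator `L` -/

section Operators

variable {k n r m : ℕ} {p : ENNReal} {a b : ℝ} [hab : Fact (a < b)] [hp : Fact (1 ≤ p)]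

theorem memLp_const_add_integral (q : ENNReal) (c : ℂ) (f : Lp ℂ p (intervalMeasure a b)) :
    MemLp (fun t => c + ∫ s in a..t, f s) q (intervalMeasure a b) :=
  (memLp_const c).add (memLp_integral q f)

/-- If multiplication maps `W^k_p × W^(k+1)_p` to `W^k_p`, then `W^(k+1)_p` is an algebra. -/
theorem mul_mem_succ_of_mul_mem
    (hk : ∀ u ∈ sobolevSubmodule k p a b, ∀ v ∈ sobolevSubmodule (k + 1) p a b,
      ∀ x : Lp ℂ p (intervalMeasure a b), x =ᵐ[intervalMeasure a b] (fun t => u t * v t) →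
        x ∈ sobolevSubmodule k p a b)
    {u v x : Lp ℂ p (intervalMeasure a b)} (hu : u ∈ sobolevSubmodule (k + 1) p a b)
    (hv : v ∈ sobolevSubmodule (k + 1) p a b)
    (hx : x =ᵐ[intervalMeasure a b] fun t => u t * v t) :
    x ∈ sobolevSubmodule (k + 1) p a b := by
  obtain ⟨f, hf, c, hu'⟩ := exists_eq_primitive_add_const hu
  obtain ⟨g, hg, d, hv'⟩ := exists_eq_primitive_add_const hv
  have huF : u =ᵐ[intervalMeasure a b] fun t => c + ∫ s in a..t, f s :=
    hu' ▸ coeFn_primitive_add_const f c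
  have hvG : v =ᵐ[intervalMeasure a b] fun t => d + ∫ s in a..t, g s :=
    hv' ▸ coeFn_primitive_add_const g d
  have h1 : MemLp (fun t => f t * (d + ∫ s in a..t, g s)) p (intervalMeasure a b) :=
    MemLp.mul' (p := p) (q := ⊤) (memLp_const_add_integral ⊤ d g) (Lp.memLp f)
  have h2 : MemLp (fun t => (c + ∫ s in a..t, f s) * g t) p (intervalMeasure a b) :=
    MemLp.mul' (p := ⊤) (q := p) (Lp.memLp g) (memLp_const_add_integral ⊤ c f)
  -- The derivative of `u v` is `f v + u g`, and each summand is a product of a `W^k_p` and a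
  -- `W^(k+1)_p` function, as `hk` demands.
  have m1 : h1.toLp _ ∈ sobolevSubmodule k p a b := by
    refine hk f hf v hv _ (h1.coeFn_toLp.trans ?_)
    filter_upwards [hvG] with t ht
    rw [ht]
  have m2 : h2.toLp _ ∈ sobolevSubmodule k p a b := by
    refine hk g hg u hu _ (h2.coeFn_toLp.trans ?_)
    filter_upwards [huF] with t ht
    rw [ht, mul_comm]
  have hxe : x = primitive p (h1.toLp _ + h2.toLp _) +
      Lp.constL p (intervalMeasure a b) ℂ (c * d) := by
    refine Lp.ext ((hx.trans ?_).trans (coeFn_primitive_add_const _ _).symm)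
    filter_upwards [huF, hvG, ae_restrict_mem measurableSet_Icc] with t h3 h4 ht
    rw [h3, h4, const_add_integral_mul (intervalIntegrable_coeFn f) (intervalIntegrable_coeFn g)
      c d (by rwa [uIcc_of_le hab.out.le])]
    congr 1
    refine integral_congr_of_ae_eq ?_ ht
    filter_upwards [Lp.coeFn_add (h1.toLp _) (h2.toLp _), h1.coeFn_toLp, h2.coeFn_toLp]
      with s h5 h6 h7
    rw [h5, Pi.add_apply, h6, h7]
  rw [hxe]
  exact primitive_add_const_mem (Submodule.add_mem _ m1 m2) _

/-- Induction on `k`: once `W^k_p` is a module over `W^(k+1)_p`, the Leibniz rule makes `W^(k+1)_p`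
an algebra, and so in particular a module over the smaller `W^(k+2)_p`. The asymmetric form is
needed because `L_p` itself is not closed under products. -/
theorem mul_mem {u v x : Lp ℂ p (intervalMeasure a b)} (hu : u ∈ sobolevSubmodule k p a b)
    (hv : v ∈ sobolevSubmodule (k + 1) p a b)
    (hx : x =ᵐ[intervalMeasure a b] fun t => u t * v t) :
    x ∈ sobolevSubmodule k p a b := by
  induction k generalizing u v x with
  | zero => exact mem_sobolevSubmodule_zero x
  | succ k ih =>
    exact mul_mem_succ_of_mul_mem (fun u hu v hv x hx => ih hu hv hx) hu
      (sobolevSubmodule_succ_le _ hv) hx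

theorem mul_mem_succ {u v x : Lp ℂ p (intervalMeasure a b)}
    (hu : u ∈ sobolevSubmodule (k + 1) p a b) (hv : v ∈ sobolevSubmodule (k + 1) p a b)
    (hx : x =ᵐ[intervalMeasure a b] fun t => u t * v t) :
    x ∈ sobolevSubmodule (k + 1) p a b :=
  mul_mem_succ_of_mul_mem (fun _ hu _ hv _ hx => mul_mem hu hv hx) hu hv hx

/-- Multiplication of bounded functions by a fixed element of `L_p`. -/
def lpMul (A : Lp ℂ p (intervalMeasure a b)) :
    Lp ℂ ⊤ (intervalMeasure a b) →L[ℂ] Lp ℂ p (intervalMeasure a b) :=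
  (ContinuousLinearMap.mul ℂ ℂ).holderL (intervalMeasure a b) p ⊤ p A

theorem coeFn_lpMul (A : Lp ℂ p (intervalMeasure a b)) (w : Lp ℂ ⊤ (intervalMeasure a b)) :
    lpMul A w =ᵐ[intervalMeasure a b] fun t => A t * w t :=
  (ContinuousLinearMap.mul ℂ ℂ).coeFn_holder A w

namespace Sobolev

theorem derivative_mem (u : Sobolev n p a b) (j : Fin (n + 1)) (h : j + k ≤ n) :
    derivative j u ∈ sobolevSubmodule k p a b := by
  induction n generalizing k with
  | zero =>
    obtain rfl : k = 0 := by omega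
    exact mem_sobolevSubmodule_zero _
  | succ n ih =>
    induction j using Fin.cases with
    | zero =>
      rw [derivative_zero]
      exact sobolevSubmodule_anti (by simpa using h) u.toLp_mem
    | succ j =>
      obtain ⟨x, rfl⟩ := integrate.surjective u
      rw [derivative_succ_integrate]
      exact ih x.1 j (by rw [Fin.val_succ] at h; omega)

/-- A bounded operator into `L_p` with values in `W^k_p` is bounded as an operator
into `W^k_p`. -/
def codRestrict {X : Type*} [NormedAddCommGroup X] [NormedSpace ℂ X] [CompleteSpace X]
    (g : X →L[ℂ] Lp ℂ p (intervalMeasure a b)) (h : ∀ x, g x ∈ sobolevSubmodule k p a b) :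
    X →L[ℂ] Sobolev k p a b where
  toLinearMap := (LinearMap.codRestrict (sobolevSubmodule k p a b) g.toLinearMap h :
    X →ₗ[ℂ] Sobolev k p a b)
  cont := by
    -- Closed graph theorem: convergence in `W^k_p` implies convergence in `L_p`, where limits are
    -- unique.
    refine LinearMap.continuous_of_seq_closed_graph (F := Sobolev k p a b)
      (LinearMap.codRestrict (sobolevSubmodule k p a b) g.toLinearMap h) fun u x y hu hy => ?_
    have h1 := ((toLpL (k := k) (p := p) (a := a) (b := b)).continuous.tendsto y).comp hy
    have h2 := (g.continuous.tendsto x).comp hu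
    rw [toLpL_apply] at h1
    refine toLp_injective (tendsto_nhds_unique h1 (h2.congr fun i => ?_))
    have e := toLpL_apply (k := k) (p := p) (a := a) (b := b) (⟨g (u i), h (u i)⟩)
    exact e.symm

/-- The embedding of `W^(k+1)_p` into the bounded functions. -/
def toLinfty : Sobolev (k + 1) p a b →L[ℂ] Lp ℂ ⊤ (intervalMeasure a b) :=
  (((primitive ⊤).comp toLpL).coprod (Lp.constL ⊤ (intervalMeasure a b) ℂ)).comp
    (integrate (k := k) (p := p) (a := a) (b := b)).symm.toContinuousLinearMap

theorem coeFn_toLinfty (u : Sobolev (k + 1) p a b) :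
    toLinfty u =ᵐ[intervalMeasure a b] u.toLp := by
  obtain ⟨x, rfl⟩ := integrate.surjective u
  have e : toLinfty (integrate x) =
      primitive ⊤ x.1.toLp + Lp.constL ⊤ (intervalMeasure a b) ℂ x.2 := by
    simp [toLinfty]
  rw [e, toLp_integrate]
  refine Filter.EventuallyEq.trans ?_ (coeFn_primitive_add_const _ _).symm
  filter_upwards [Lp.coeFn_add (primitive ⊤ x.1.toLp) (Lp.constL ⊤ (intervalMeasure a b) ℂ x.2),
    coeFn_primitive ⊤ x.1.toLp, Lp.coeFn_const ⊤ (intervalMeasure a b) x.2] with t h1 h2 h3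
  rw [h1, Pi.add_apply, h2, Lp.constL_apply, h3, Function.const_apply, add_comm]

/-- The derivative of order `j < k`, as a bounded operator from `W^k_p` to the bounded
functions. -/
def derivativeLinfty (j : ℕ) (hj : j < k) :
    Sobolev k p a b →L[ℂ] Lp ℂ ⊤ (intervalMeasure a b) :=
  (toLinfty (k := 0)).comp (codRestrict (derivativeL ⟨j, by omega⟩)
    fun u => derivative_mem u ⟨j, by omega⟩ (k := 1) hj)

theorem coeFn_derivativeLinfty (j : ℕ) (hj : j < k) (u : Sobolev k p a b) :
    derivativeLinfty j hj u =ᵐ[intervalMeasure a b] derivative ⟨j, by omega⟩ u :=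
  coeFn_toLinfty _

/-- The isomorphism `W^n_p × ℂ^r ≃ W^(n+r)_p` inverse to `y ↦ y^(r)` together with the values
of `y, …, y^(r-1)` at `a`. -/
def integrateIter : (r : ℕ) → (Sobolev n p a b × (Fin r → ℂ)) ≃ₗ[ℂ] Sobolev (n + r) p a b
  | 0 => LinearEquiv.prodUnique
  | r + 1 =>
    ((LinearEquiv.refl ℂ (Sobolev n p a b)).prodCongr
      ((Fin.consLinearEquiv ℂ fun _ : Fin (r + 1) => ℂ).symm.trans
        (LinearEquiv.prodComm ℂ ℂ (Fin r → ℂ)))).trans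
    ((LinearEquiv.prodAssoc ℂ (Sobolev n p a b) (Fin r → ℂ) ℂ).symm.trans
      (((integrateIter r).prodCongr (LinearEquiv.refl ℂ ℂ)).trans
        (integrate (k := n + r)).toLinearEquiv))

theorem integrateIter_succ (z : Sobolev n p a b) :
    integrateIter (r + 1) (z, 0) = integrate (integrateIter r (z, 0), 0) := rfl

/-- With zero constants `y` is the `r`-fold primitive of `z`, and each differentiation undoes one
integration. -/
theorem derivative_integrateIter (z : Sobolev n p a b) (j : ℕ) (hj : j ≤ r) :
    derivative ⟨j, by omega⟩ (integrateIter r (z, 0)) =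
      ((primitive p : Lp ℂ p (intervalMeasure a b) →L[ℂ] _) ^ (r - j)) z.toLp := by
  induction r generalizing j with
  | zero =>
    obtain rfl : j = 0 := by omega
    exact derivative_zero z
  | succ r ih =>
    rw [integrateIter_succ]
    cases j with
    | zero =>
      refine (derivative_zero _).trans ?_
      have h0 := (derivative_zero _).symm.trans (ih 0 (Nat.zero_le r))
      rw [toLp_integrate, h0, Nat.sub_zero, Nat.sub_zero, pow_succ', map_zero, add_zero]
      rfl
    | succ j =>
      refine (derivative_succ_integrate (integrateIter r (z, 0), 0) ⟨j, by omega⟩).trans ?_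
      rw [ih j (by omega), Nat.add_sub_add_right]

end Sobolev

open Sobolev

/-- The `i`-th component of `L y`, as an element of `L_p`. -/
def diffOpLp (A : Fin r → Matrix (Fin m) (Fin m) (Sobolev n p a b)) (i : Fin m) :
    SobolevVec m (n + r) p a b →L[ℂ] Lp ℂ p (intervalMeasure a b) :=
  (derivativeL ⟨r, by omega⟩).comp (PiLp.proj 1 _ i) +
    ∑ j : Fin r, ∑ q : Fin m, (lpMul (A j i q).toLp).comp
      ((derivativeLinfty j (by omega)).comp (PiLp.proj 1 _ q))

theorem diffOpLp_apply (A : Fin r → Matrix (Fin m) (Fin m) (Sobolev n p a b)) (i : Fin m)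
    (y : SobolevVec m (n + r) p a b) :
    diffOpLp A i y = derivative ⟨r, by omega⟩ (y i) +
      ∑ j : Fin r, ∑ q : Fin m, lpMul (A j i q).toLp (derivativeLinfty j (by omega) (y q)) := by
  simp [diffOpLp]

theorem coeFn_finset_sum {ι : Type*} (s : Finset ι) (f : ι → Lp ℂ p (intervalMeasure a b)) :
    (∑ i ∈ s, f i : Lp ℂ p (intervalMeasure a b))
      =ᵐ[intervalMeasure a b] fun t => ∑ i ∈ s, f i t := by
  classical
  induction s using Finset.induction_on with
  | empty =>
    simp only [Finset.sum_empty]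
    exact Lp.coeFn_zero ℂ p (intervalMeasure a b)
  | insert i s hi ih =>
    rw [Finset.sum_insert hi]
    filter_upwards [Lp.coeFn_add (f i) (∑ i ∈ s, f i), ih] with t h1 h2
    rw [h1, Pi.add_apply, h2, Finset.sum_insert hi]

theorem coeFn_diffOpLp (A : Fin r → Matrix (Fin m) (Fin m) (Sobolev n p a b)) (i : Fin m)
    (y : SobolevVec m (n + r) p a b) :
    diffOpLp A i y =ᵐ[intervalMeasure a b] diffExpr A y i := by
  have hterm : ∀ᵐ t ∂(intervalMeasure a b), ∀ j : Fin r, ∀ q : Fin m,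
      lpMul (A j i q).toLp (derivativeLinfty j (by omega) (y q)) t =
        A j i q t * derivative ⟨j, by omega⟩ (y q) t := by
    refine ae_all_iff.2 fun j => ae_all_iff.2 fun q => ?_
    filter_upwards [coeFn_lpMul (A j i q).toLp (derivativeLinfty j (by omega) (y q)),
      coeFn_derivativeLinfty (j : ℕ) (by omega) (y q)] with t h1 h2
    rw [h1, h2]
  have hsum : ∀ᵐ t ∂(intervalMeasure a b), ∀ j : Fin r,
      (∑ q : Fin m, lpMul (A j i q).toLp (derivativeLinfty j (by omega) (y q)) :
        Lp ℂ p (intervalMeasure a b)) t =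
      ∑ q : Fin m, lpMul (A j i q).toLp (derivativeLinfty j (by omega) (y q)) t :=
    ae_all_iff.2 fun j => coeFn_finset_sum _ _
  rw [diffOpLp_apply]
  filter_upwards [Lp.coeFn_add (derivative ⟨r, by omega⟩ (y i))
      (∑ j : Fin r, ∑ q : Fin m, lpMul (A j i q).toLp (derivativeLinfty j (by omega) (y q))),
    coeFn_finset_sum Finset.univ fun j : Fin r =>
      ∑ q : Fin m, lpMul (A j i q).toLp (derivativeLinfty j (by omega) (y q)),
    hterm, hsum] with t h1 h2 h3 h4
  rw [h1, Pi.add_apply, h2, diffExpr]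
  simp only [h4, h3]

/-- For `j < r`, the derivative `y^(j)` of `y ∈ W^(n+r)_p` lies in `W^(n+1)_p`, one order better
than the coefficients; this is exactly the margin that `mul_mem` requires. -/
theorem diffOpLp_mem (A : Fin r → Matrix (Fin m) (Fin m) (Sobolev n p a b)) (i : Fin m)
    (y : SobolevVec m (n + r) p a b) : diffOpLp A i y ∈ sobolevSubmodule n p a b := by
  rw [diffOpLp_apply]
  refine Submodule.add_mem _ (derivative_mem _ _ (by simp [add_comm]))
    (Submodule.sum_mem _ fun j _ => Submodule.sum_mem _ fun q _ => ?_)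
  refine mul_mem (A j i q).toLp_mem
    (derivative_mem (y q) ⟨j, by omega⟩ (k := n + 1) (by simp; omega))
    ((coeFn_lpMul _ _).trans ?_)
  filter_upwards [coeFn_derivativeLinfty (j : ℕ) (by omega) (y q)] with t h
  rw [h]

/-- The differential operator `L : (W^(n+r)_p)^m → (W^n_p)^m`. -/
def diffOp (A : Fin r → Matrix (Fin m) (Fin m) (Sobolev n p a b)) :
    SobolevVec m (n + r) p a b →L[ℂ] SobolevVec m n p a b :=
  (PiLp.continuousLinearEquiv 1 ℂ fun _ : Fin m => Sobolev n p a b).symm.toContinuousLinearMap.comp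
    (ContinuousLinearMap.pi fun i => codRestrict (diffOpLp A i) (diffOpLp_mem A i))

theorem toLp_diffOp (A : Fin r → Matrix (Fin m) (Fin m) (Sobolev n p a b))
    (y : SobolevVec m (n + r) p a b) (i : Fin m) : (diffOp A y i).toLp = diffOpLp A i y := rfl

end Operators

/-! ### Volterra estimates and invertibility of `1 + K` -/

section Volterra

variable {m r : ℕ} {p : ENNReal} {a b : ℝ}

theorem absolutelyContinuous_pow {f : ℝ → ℝ} (hf : AbsolutelyContinuousOnInterval f a b)
    (k : ℕ) : AbsolutelyContinuousOnInterval (fun t => f t ^ (k + 1)) a b := by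
  induction k with
  | zero => simpa using hf
  | succ k ih =>
    simp only [pow_succ _ (k + 1)]
    exact ih.mul hf

/-- The integrand is the derivative of the right-hand side. These denominators accumulate to `k!`
under iteration. -/
theorem integral_mul_integral_pow {α : ℝ → ℝ} (hα : IntervalIntegrable α volume a b) (k : ℕ)
    {t : ℝ} (ht : t ∈ uIcc a b) :
    ∫ s in a..t, α s * (∫ x in a..s, α x) ^ k = (∫ x in a..t, α x) ^ (k + 1) / (k + 1) := by
  have hβ := absolutelyContinuous_integral hα
  have hc : ContinuousOn (fun s => ((k + 1 : ℕ) : ℝ) * (∫ x in a..s, α x) ^ k) (uIcc a b) :=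
    continuousOn_const.mul (hβ.continuousOn.pow k)
  have key := eq_add_integral_of_ae_hasDerivAt (absolutelyContinuous_pow hβ k)
    (hα.continuousOn_mul hc) ?_ ht
  · simp only [intervalIntegral.integral_same, ne_eq, Nat.add_eq_zero_iff, one_ne_zero,
      and_false, not_false_eq_true, zero_pow, zero_add] at key
    rw [key, eq_div_iff (by positivity), mul_comm, ← intervalIntegral.integral_const_mul]
    refine intervalIntegral.integral_congr fun s _ => ?_
    push_cast
    ring
  · filter_upwards [ae_hasDerivAt_const_add_integral 0 hα] with s hs hmem
    have h := (hs hmem).fun_pow (k + 1)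
    simpa using h

variable [hab : Fact (a < b)] [hp : Fact (1 ≤ p)]

/-- The `L_1` norm over `[a, t]` of an `L_p` vector function. -/
def normIntegral (z : Fin m → Lp ℂ p (intervalMeasure a b)) (t : ℝ) : ℝ :=
  ∫ s in a..t, ∑ q, ‖z q s‖

theorem intervalIntegrable_sum_norm (z : Fin m → Lp ℂ p (intervalMeasure a b)) :
    IntervalIntegrable (fun s => ∑ q, ‖z q s‖) volume a b := by
  have := IntervalIntegrable.sum Finset.univ fun q _ => (intervalIntegrable_coeFn (z q)).norm
  refine this.congr fun s _ => ?_
  simp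

theorem normIntegral_mono (z : Fin m → Lp ℂ p (intervalMeasure a b)) {s t : ℝ} (hs : a ≤ s)
    (hst : s ≤ t) (ht : t ≤ b) : normIntegral z s ≤ normIntegral z t :=
  intervalIntegral.integral_mono_interval le_rfl hs hst
    (Filter.Eventually.of_forall fun _ => Finset.sum_nonneg fun _ _ => norm_nonneg _)
    (intervalIntegrable_of_mem (intervalIntegrable_sum_norm z) left_mem_uIcc
      (by rw [uIcc_of_le hab.out.le]; exact ⟨hs.trans hst, ht⟩))

theorem normIntegral_nonneg (z : Fin m → Lp ℂ p (intervalMeasure a b)) {t : ℝ} (ht : a ≤ t) :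
    0 ≤ normIntegral z t :=
  intervalIntegral.integral_nonneg ht fun _ _ => Finset.sum_nonneg fun _ _ => norm_nonneg _

/-- Induction on `k`, inserting the bound at each `s ≤ t` under the integral. The `t`-dependence
must be kept: a bound over all of `[a, b]` would lose the factorial. -/
theorem normIntegral_iterate_le {K : (Fin m → Lp ℂ p (intervalMeasure a b)) →
      (Fin m → Lp ℂ p (intervalMeasure a b))} {α : ℝ → ℝ}
    (hα : IntervalIntegrable α volume a b) (hα0 : ∀ t, 0 ≤ α t)
    (hK : ∀ z, ∀ᵐ t ∂(intervalMeasure a b), ∑ i, ‖K z i t‖ ≤ α t * normIntegral z t)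
    (k : ℕ) (z : Fin m → Lp ℂ p (intervalMeasure a b)) {t : ℝ} (ht : t ∈ Icc a b) :
    normIntegral (K^[k] z) t ≤
      normIntegral z b * ((∫ s in a..t, α s) ^ k / k.factorial) := by
  induction k generalizing t with
  | zero => simpa using normIntegral_mono z ht.1 ht.2 le_rfl
  | succ k ih =>
    rw [Function.iterate_succ_apply']
    set w := K^[k] z
    have hmem : t ∈ uIcc a b := by rwa [uIcc_of_le hab.out.le]
    have hint : IntervalIntegrable
        (fun s => normIntegral z b / k.factorial * (α s * (∫ x in a..s, α x) ^ k))
        volume a b :=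
      (hα.mul_continuousOn ((absolutelyContinuous_integral hα).continuousOn.pow k)).const_mul _
    calc normIntegral (K w) t
        ≤ ∫ s in a..t, normIntegral z b / k.factorial * (α s * (∫ x in a..s, α x) ^ k) := by
          refine intervalIntegral.integral_mono_ae_restrict ht.1
            (intervalIntegrable_of_mem (intervalIntegrable_sum_norm _) left_mem_uIcc hmem)
            (intervalIntegrable_of_mem hint left_mem_uIcc hmem) ?_
          refine ae_restrict_of_ae_restrict_of_subset (Icc_subset_Icc_right ht.2) ?_
          filter_upwards [hK w, ae_restrict_mem measurableSet_Icc] with s h1 hs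
          refine h1.trans ((mul_le_mul_of_nonneg_left (ih hs) (hα0 s)).trans_eq ?_)
          ring
      _ = normIntegral z b * ((∫ s in a..t, α s) ^ (k + 1) / (k + 1).factorial) := by
          rw [intervalIntegral.integral_const_mul, integral_mul_integral_pow hα k hmem,
            Nat.factorial_succ]
          push_cast
          field_simp

theorem exists_normIntegral_le (m : ℕ) (p : ENNReal) (a b : ℝ) [hab : Fact (a < b)]
    [hp : Fact (1 ≤ p)] : ∃ C : ℝ, 0 ≤ C ∧
      ∀ z : Fin m → Lp ℂ p (intervalMeasure a b), normIntegral z b ≤ C * ‖z‖ := by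
  obtain ⟨C, hC, h⟩ := exists_integral_norm_le p a b
  refine ⟨m * C, by positivity, fun z => ?_⟩
  rw [normIntegral, intervalIntegral.integral_finsetSum
    fun q _ => (intervalIntegrable_coeFn (z q)).norm]
  calc ∑ q, ∫ s in a..b, ‖z q s‖ ≤ ∑ _q : Fin m, C * ‖z‖ :=
        Finset.sum_le_sum fun q _ => (h (z q)).trans
          (mul_le_mul_of_nonneg_left (norm_le_pi_norm z q) hC)
    _ = m * C * ‖z‖ := by simp [mul_assoc]

/-- The unit `1 - (-x)^k` factors as `1 + x` times a geometric sum, and commuting factors of a unit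
are units. -/
theorem isUnit_one_add_of_norm_pow_lt_one {R : Type*} [NormedRing R] [HasSummableGeomSeries R]
    {x : R} {k : ℕ} (h : ‖x ^ k‖ < 1) : IsUnit (1 + x) := by
  have hlt : ‖(-x) ^ k‖ < 1 := by
    rcases Nat.even_or_odd k with hk | hk
    · rwa [hk.neg_pow]
    · rwa [hk.neg_pow, norm_neg]
  have hu : IsUnit ((1 - -x) * ∑ i ∈ Finset.range k, (-x) ^ i) := by
    rw [mul_neg_geom_sum]
    exact isUnit_one_sub_of_norm_lt_one hlt
  have hcomm : Commute (1 - -x) (∑ i ∈ Finset.range k, (-x) ^ i) :=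
    Commute.sum_right _ _ _ fun i _ =>
      ((Commute.one_left _).sub_left (Commute.refl _)).pow_right i
  simpa using (hcomm.isUnit_mul_iff.1 hu).1

/-- A Volterra operator on `L_p` vector functions is quasinilpotent, so `1 + K` is
invertible. -/
theorem isUnit_one_add_of_volterra
    {K : (Fin m → Lp ℂ p (intervalMeasure a b)) →L[ℂ] (Fin m → Lp ℂ p (intervalMeasure a b))}
    {α : ℝ → ℝ} (hα : IntervalIntegrable α volume a b) (hα0 : ∀ t, 0 ≤ α t)
    (hK : ∀ z, ∀ᵐ t ∂(intervalMeasure a b), ∑ i, ‖K z i t‖ ≤ α t * normIntegral z t)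
    {D : ℝ} (hD : 0 ≤ D) (hKD : ∀ z, ‖K z‖ ≤ D * normIntegral z b) : IsUnit (1 + K) := by
  obtain ⟨C, hC, hCz⟩ := exists_normIntegral_le m p a b
  set β := ∫ s in a..b, α s
  have hβ : 0 ≤ β := intervalIntegral.integral_nonneg hab.out.le fun s _ => hα0 s
  -- Of the `k + 1` applications, `k` are estimated in `L_1`; the last returns to the `L_p` norm
  -- through `hKD`.
  have hbound (k : ℕ) : ‖K ^ (k + 1)‖ ≤ D * C * (β ^ k / k.factorial) := by
    refine ContinuousLinearMap.opNorm_le_bound _ (by positivity) fun z => ?_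
    have e : (K ^ (k + 1)) z = K (K^[k] z) := by
      rw [pow_succ', mul_apply_eq_comp, FunLike.coe_pow_eq_iterate]
    rw [e]
    calc ‖K (K^[k] z)‖ ≤ D * normIntegral (K^[k] z) b := hKD _
      _ ≤ D * (normIntegral z b * (β ^ k / k.factorial)) := by
          gcongr
          exact normIntegral_iterate_le hα hα0 hK k z (right_mem_Icc.2 hab.out.le)
      _ ≤ D * (C * ‖z‖ * (β ^ k / k.factorial)) := by
          gcongr
          exact hCz z
      _ = D * C * (β ^ k / k.factorial) * ‖z‖ := by ring
  have hlim : Filter.Tendsto (fun k : ℕ => D * C * (β ^ k / k.factorial)) Filter.atTop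
      (nhds 0) := by
    simpa using (FloorSemiring.tendsto_pow_div_factorial_atTop β).const_mul (D * C)
  obtain ⟨k, hk⟩ := (hlim.eventually_lt_const zero_lt_one).exists
  exact isUnit_one_add_of_norm_pow_lt_one ((hbound k).trans_lt hk)

/-- The operator `z ↦ ∑ⱼ Aⱼ J^(r-j) z`, where `J` is integration from `a`. -/
def volterra (A : Fin r → Fin m → Fin m → Lp ℂ p (intervalMeasure a b)) :
    (Fin m → Lp ℂ p (intervalMeasure a b)) →L[ℂ] (Fin m → Lp ℂ p (intervalMeasure a b)) :=
  ContinuousLinearMap.pi fun i => ∑ j : Fin r, ∑ q : Fin m,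
    -- One of the `r - j ≥ 1` integrations is taken into `L_∞`, leaving the exponent `r - 1 - j`, so
    -- that multiplying by an `L_p` coefficient makes sense.
    (lpMul (A j i q)).comp (((primitive ⊤).comp
      ((primitive p : Lp ℂ p (intervalMeasure a b) →L[ℂ] _) ^ (r - 1 - j))).comp
        (ContinuousLinearMap.proj q))

theorem volterra_apply (A : Fin r → Fin m → Fin m → Lp ℂ p (intervalMeasure a b))
    (z : Fin m → Lp ℂ p (intervalMeasure a b)) (i : Fin m) :
    volterra A z i = ∑ j : Fin r, ∑ q : Fin m, lpMul (A j i q) (primitive ⊤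
      (((primitive p : Lp ℂ p (intervalMeasure a b) →L[ℂ] _) ^ (r - 1 - (j : ℕ))) (z q))) := by
  simp [volterra]

/-- Each extra integration costs at most a factor `b - a`. The integral on the right stops at `t`,
which is the Volterra property. -/
theorem norm_integral_primitive_pow_le (i : ℕ) (z : Lp ℂ p (intervalMeasure a b)) {t : ℝ}
    (ht : t ∈ Icc a b) :
    ‖∫ s in a..t, ((primitive p : Lp ℂ p (intervalMeasure a b) →L[ℂ] _) ^ i) z s‖ ≤
      (b - a) ^ i * ∫ s in a..t, ‖z s‖ := by
  induction i generalizing t with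
  | zero => simpa using intervalIntegral.norm_integral_le_integral_norm ht.1
  | succ i ih =>
    have hba : 0 ≤ b - a := sub_nonneg.2 hab.out.le
    have hsub : Icc a t ⊆ Icc a b := Icc_subset_Icc_right ht.2
    have hN : 0 ≤ ∫ s in a..t, ‖z s‖ :=
      intervalIntegral.integral_nonneg ht.1 fun _ _ => norm_nonneg _
    have hb : ∀ᵐ s, s ∈ uIoc a t →
        ‖((primitive p : Lp ℂ p (intervalMeasure a b) →L[ℂ] _) ^ (i + 1)) z s‖ ≤
          (b - a) ^ i * ∫ s in a..t, ‖z s‖ := by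
      have h1 := coeFn_primitive p
        (((primitive p : Lp ℂ p (intervalMeasure a b) →L[ℂ] _) ^ i) z)
      filter_upwards [(ae_restrict_iff' measurableSet_Icc).1 h1] with s hs hmem
      rw [uIoc_of_le ht.1] at hmem
      have hsI : s ∈ Icc a b := hsub ⟨hmem.1.le, hmem.2⟩
      rw [pow_succ', mul_apply_eq_comp, hs hsI]
      refine (ih hsI).trans (mul_le_mul_of_nonneg_left ?_ (by positivity))
      exact intervalIntegral.integral_mono_interval le_rfl hsI.1 hmem.2
        (Filter.Eventually.of_forall fun _ => norm_nonneg _)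
        (intervalIntegrable_coeFn_of_mem z ht).norm
    refine (intervalIntegral.norm_integral_le_of_norm_le_const_ae hb).trans ?_
    rw [abs_of_nonneg (sub_nonneg.2 ht.1)]
    calc (b - a) ^ i * (∫ s in a..t, ‖z s‖) * (t - a)
        ≤ (b - a) ^ i * (∫ s in a..t, ‖z s‖) * (b - a) := by
          gcongr
          exact ht.2
      _ = _ := by ring

theorem norm_primitive_pow_le {i : ℕ} (hi : i ≤ r) (z : Fin m → Lp ℂ p (intervalMeasure a b))
    (q : Fin m) : ∀ᵐ t ∂(intervalMeasure a b),
      ‖primitive ⊤ (((primitive p : Lp ℂ p (intervalMeasure a b) →L[ℂ] _) ^ i) (z q)) t‖ ≤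
        (1 + (b - a)) ^ r * normIntegral z t := by
  have hba : 0 ≤ b - a := sub_nonneg.2 hab.out.le
  filter_upwards [coeFn_primitive ⊤
      (((primitive p : Lp ℂ p (intervalMeasure a b) →L[ℂ] _) ^ i) (z q)),
    ae_restrict_mem measurableSet_Icc] with t h1 ht
  rw [h1]
  have hmem : t ∈ uIcc a b := by rwa [uIcc_of_le hab.out.le]
  refine (norm_integral_primitive_pow_le i (z q) ht).trans (mul_le_mul ?_ ?_ ?_ (by positivity))
  -- Adding `1` gives a base at least `1`, so one constant serves all exponents `i ≤ r`, even when
  -- `b - a < 1`.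
  · calc (b - a) ^ i ≤ (1 + (b - a)) ^ i := by gcongr; linarith
      _ ≤ (1 + (b - a)) ^ r := pow_le_pow_right₀ (by linarith) hi
  · refine intervalIntegral.integral_mono_on ht.1 (intervalIntegrable_coeFn_of_mem _ ht).norm
      (intervalIntegrable_of_mem (intervalIntegrable_sum_norm z) left_mem_uIcc hmem)
      fun s _ => ?_
    exact Finset.single_le_sum (f := fun q => ‖z q s‖) (fun _ _ => norm_nonneg _)
      (Finset.mem_univ q)
  · exact intervalIntegral.integral_nonneg ht.1 fun _ _ => norm_nonneg _

theorem isUnit_one_add_volterra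
    (A : Fin r → Fin m → Fin m → Lp ℂ p (intervalMeasure a b)) :
    IsUnit (1 + volterra A) := by
  have hba : 0 ≤ b - a := sub_nonneg.2 hab.out.le
  set C := (1 + (b - a)) ^ r with hC
  have hC0 : 0 ≤ C := by positivity
  -- `α` sums the moduli of all coefficient entries and is integrable because `L_p ⊆ L_1`; `D` is
  -- the same sum with `L_p` norms.
  refine isUnit_one_add_of_volterra
    (α := fun t => C * ∑ i : Fin m, ∑ j : Fin r, ∑ q : Fin m, ‖A j i q t‖) ?_ ?_ ?_
    (D := C * ∑ i : Fin m, ∑ j : Fin r, ∑ q : Fin m, ‖A j i q‖) (by positivity) ?_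
  · refine IntervalIntegrable.const_mul ?_ _
    have := IntervalIntegrable.sum (Finset.univ : Finset (Fin m × Fin r × Fin m)) fun x _ =>
      (intervalIntegrable_coeFn (A x.2.1 x.1 x.2.2)).norm
    refine this.congr fun s _ => ?_
    simp [Fintype.sum_prod_type]
  · exact fun t => by positivity
  · intro z
    have h1 : ∀ᵐ t ∂(intervalMeasure a b), ∀ i : Fin m, ∀ j : Fin r, ∀ q : Fin m,
        ‖lpMul (A j i q) (primitive ⊤ (((primitive p : Lp ℂ p (intervalMeasure a b) →L[ℂ] _) ^
          (r - 1 - (j : ℕ))) (z q))) t‖ ≤ ‖A j i q t‖ * (C * normIntegral z t) := by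
      refine ae_all_iff.2 fun i => ae_all_iff.2 fun j => ae_all_iff.2 fun q => ?_
      filter_upwards [coeFn_lpMul (A j i q) (primitive ⊤
        (((primitive p : Lp ℂ p (intervalMeasure a b) →L[ℂ] _) ^ (r - 1 - (j : ℕ))) (z q))),
        norm_primitive_pow_le (i := r - 1 - j) (r := r) (by omega) z q] with t h1 h2
      rw [h1, norm_mul]
      gcongr
    have h2 : ∀ᵐ t ∂(intervalMeasure a b), ∀ i : Fin m, volterra A z i t =
        ∑ j : Fin r, (∑ q : Fin m, lpMul (A j i q) (primitive ⊤
          (((primitive p : Lp ℂ p (intervalMeasure a b) →L[ℂ] _) ^ (r - 1 - (j : ℕ))) (z q))) :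
            Lp ℂ p (intervalMeasure a b)) t := by
      refine ae_all_iff.2 fun i => ?_
      rw [volterra_apply]
      exact coeFn_finset_sum _ _
    have h3 : ∀ᵐ t ∂(intervalMeasure a b), ∀ i : Fin m, ∀ j : Fin r,
        (∑ q : Fin m, lpMul (A j i q) (primitive ⊤
          (((primitive p : Lp ℂ p (intervalMeasure a b) →L[ℂ] _) ^ (r - 1 - (j : ℕ))) (z q))) :
            Lp ℂ p (intervalMeasure a b)) t =
        ∑ q : Fin m, lpMul (A j i q) (primitive ⊤
          (((primitive p : Lp ℂ p (intervalMeasure a b) →L[ℂ] _) ^ (r - 1 - (j : ℕ))) (z q))) t :=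
      ae_all_iff.2 fun i => ae_all_iff.2 fun j => coeFn_finset_sum _ _
    filter_upwards [h1, h2, h3] with t h1 h2 h3
    calc ∑ i, ‖volterra A z i t‖
        ≤ ∑ i : Fin m, ∑ j : Fin r, ∑ q : Fin m, ‖A j i q t‖ * (C * normIntegral z t) := by
          refine Finset.sum_le_sum fun i _ => ?_
          rw [h2 i]
          refine (norm_sum_le _ _).trans (Finset.sum_le_sum fun j _ => ?_)
          rw [h3 i j]
          exact (norm_sum_le _ _).trans (Finset.sum_le_sum fun q _ => h1 i j q)
      _ = _ := by
          simp only [← Finset.sum_mul]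
          ring
  · intro z
    have hN : 0 ≤ normIntegral z b := normIntegral_nonneg z hab.out.le
    have h1 (i : Fin m) (j : Fin r) (q : Fin m) : ‖lpMul (A j i q) (primitive ⊤
        (((primitive p : Lp ℂ p (intervalMeasure a b) →L[ℂ] _) ^ (r - 1 - (j : ℕ))) (z q)))‖ ≤
          C * normIntegral z b * ‖A j i q‖ := by
      refine Lp.norm_le_mul_norm_of_ae_le_mul ?_
      filter_upwards [coeFn_lpMul (A j i q) (primitive ⊤
        (((primitive p : Lp ℂ p (intervalMeasure a b) →L[ℂ] _) ^ (r - 1 - (j : ℕ))) (z q))),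
        norm_primitive_pow_le (i := r - 1 - j) (r := r) (by omega) z q,
        ae_restrict_mem measurableSet_Icc] with t h1 h2 ht
      rw [h1, norm_mul, mul_comm]
      gcongr
      exact h2.trans (mul_le_mul_of_nonneg_left (normIntegral_mono z ht.1 ht.2 le_rfl) hC0)
    refine (pi_norm_le_iff_of_nonneg (by positivity)).2 fun i => ?_
    rw [volterra_apply]
    calc _ ≤ ∑ j : Fin r, ∑ q : Fin m, C * normIntegral z b * ‖A j i q‖ :=
          (norm_sum_le _ _).trans (Finset.sum_le_sum fun j _ =>
            (norm_sum_le _ _).trans (Finset.sum_le_sum fun q _ => h1 i j q))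
      _ = C * normIntegral z b * ∑ j : Fin r, ∑ q : Fin m, ‖A j i q‖ := by
          simp only [Finset.mul_sum]
      _ ≤ C * normIntegral z b * ∑ i : Fin m, ∑ j : Fin r, ∑ q : Fin m, ‖A j i q‖ := by
          gcongr
          exact Finset.single_le_sum (f := fun i => ∑ j : Fin r, ∑ q : Fin m, ‖A j i q‖)
            (fun i _ => by positivity) (Finset.mem_univ i)
      _ = _ := by ring

end Volterra

/-! ### Kernel and cokernel of a map with appended conditions -/

section LinearAlgebra

variable {𝕜 Z V X Y F : Type*} [Field 𝕜] [AddCommGroup Z] [Module 𝕜 Z] [AddCommGroup V]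
  [Module 𝕜 V] [AddCommGroup X] [Module 𝕜 X] [AddCommGroup Y] [Module 𝕜 Y] [AddCommGroup F]
  [Module 𝕜 F]

/-- If `M : Z × V → Y` is bijective on `Z`, then projecting to `V` is an isomorphism from the
kernel of `M` onto `V`. -/
def kerEquivOfBijectiveInl (M : Z × V →ₗ[𝕜] Y)
    (hM : Function.Bijective (M ∘ₗ LinearMap.inl 𝕜 Z V)) : LinearMap.ker M ≃ₗ[𝕜] V :=
  LinearEquiv.ofBijective (LinearMap.snd 𝕜 Z V ∘ₗ (LinearMap.ker M).subtype) (by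
    constructor
    · rw [← LinearMap.ker_eq_bot, LinearMap.ker_eq_bot']
      rintro ⟨⟨z, v⟩, hx⟩ h0
      obtain rfl : v = 0 := h0
      obtain rfl : z = 0 := hM.1 ((show M (z, 0) = 0 from hx).trans (map_zero _).symm)
      rfl
    · intro v
      -- For given `v`, the equation `M (z, v) = 0` reads `M (z, 0) = -M (0, v)`.
      obtain ⟨z, hz⟩ := hM.2 (-M (0, v))
      refine ⟨⟨(z, v), ?_⟩, rfl⟩
      have h : ((z, v) : Z × V) = (z, 0) + (0, v) := by simp
      rw [LinearMap.mem_ker, h, map_add]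
      simpa [eq_neg_iff_add_eq_zero] using hz)

theorem surjective_of_bijective_inl (M : Z × V →ₗ[𝕜] Y)
    (hM : Function.Bijective (M ∘ₗ LinearMap.inl 𝕜 Z V)) : Function.Surjective M := fun y =>
  let ⟨z, hz⟩ := hM.2 y
  ⟨(z, 0), hz⟩

variable [FiniteDimensional 𝕜 F]

/-- For surjective `L`, the kernel and cokernel of `(L, B)` are those of the restriction of `B`
to the kernel of `L`. -/
theorem finrank_ker_sub_finrank_coker_prod (L : X →ₗ[𝕜] Y) (hL : Function.Surjective L)
    [FiniteDimensional 𝕜 (LinearMap.ker L)] (B : X →ₗ[𝕜] F) :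
    (Module.finrank 𝕜 (LinearMap.ker (L.prod B)) : ℤ) -
        (Module.finrank 𝕜 ((Y × F) ⧸ LinearMap.range (L.prod B)) : ℤ) =
      (Module.finrank 𝕜 (LinearMap.ker L) : ℤ) - (Module.finrank 𝕜 F : ℤ) := by
  set D : LinearMap.ker L →ₗ[𝕜] F := B.domRestrict (LinearMap.ker L) with hD
  have e1 : LinearMap.ker (L.prod B) ≃ₗ[𝕜] LinearMap.ker D :=
    (LinearEquiv.ofEq _ _ (by
      ext x
      constructor
      · exact fun h => ⟨⟨x, congrArg Prod.fst h⟩, congrArg Prod.snd h, rfl⟩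
      · rintro ⟨⟨x, h1⟩, h2, rfl⟩
        exact Prod.ext h1 h2 : LinearMap.ker (L.prod B) =
          (LinearMap.ker D).map (LinearMap.ker L).subtype)).trans
      (Submodule.equivSubtypeMap _ _).symm
  -- Modulo the range, `(L x, d)` equals `(0, d - B x)`, so `F` maps onto the cokernel. The cokernel
  -- is thus finite-dimensional, and its `finrank` is not the default value.
  set π : F →ₗ[𝕜] (Y × F) ⧸ LinearMap.range (L.prod B) :=
    (LinearMap.range (L.prod B)).mkQ ∘ₗ LinearMap.inr 𝕜 Y F with hπ
  have hπs : Function.Surjective π := by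
    intro q
    obtain ⟨⟨y, d⟩, rfl⟩ := Submodule.mkQ_surjective _ q
    obtain ⟨x, rfl⟩ := hL y
    refine ⟨d - B x, ?_⟩
    rw [hπ, LinearMap.comp_apply, Submodule.mkQ_apply, Submodule.mkQ_apply, eq_comm,
      Submodule.Quotient.eq]
    exact ⟨x, by simp⟩
  -- `(0, d)` lies in the range exactly when `d = B x` for some `x ∈ ker L`.
  have hπk : LinearMap.ker π = LinearMap.range D := by
    ext d
    rw [LinearMap.mem_ker, hπ, LinearMap.comp_apply, Submodule.mkQ_apply,
      Submodule.Quotient.mk_eq_zero]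
    constructor
    · rintro ⟨x, hx⟩
      have h1 : L x = 0 := congrArg Prod.fst hx
      have h2 : B x = d := congrArg Prod.snd hx
      exact ⟨⟨x, h1⟩, h2⟩
    · rintro ⟨⟨x, hx⟩, rfl⟩
      exact ⟨x, Prod.ext hx rfl⟩
  have e2 := (π.quotKerEquivOfSurjective hπs).finrank_eq
  have h1 := Submodule.finrank_quotient_add_finrank (LinearMap.ker π)
  have h2 := LinearMap.finrank_range_add_finrank_ker D
  rw [hπk] at h1 e2
  rw [e1.finrank_eq]
  omega

end LinearAlgebra

/-! ### Fredholmness through a quasi-inverse -/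

section Fredholm

variable {X Y F : Type*} [NormedAddCommGroup X] [NormedSpace ℂ X] [CompleteSpace X]
  [NormedAddCommGroup Y] [NormedSpace ℂ Y] [CompleteSpace Y] [NormedAddCommGroup F]
  [NormedSpace ℂ F] [FiniteDimensional ℂ F]

/-- A finite-dimensional kernel has a closed complement; `L` is bijective on it, and the open
mapping theorem makes the inverse bounded. -/
theorem exists_rightInverse_of_finiteDimensional_ker (L : X →L[ℂ] Y)
    (hL : Function.Surjective L) [FiniteDimensional ℂ L.ker] :
    ∃ R : Y →L[ℂ] X, ∀ y, L (R y) = y := by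
  obtain ⟨G, hG, hc⟩ := Submodule.ClosedComplemented.exists_isClosed_isCompl
    (Submodule.ClosedComplemented.of_finiteDimensional L.ker)
  have : CompleteSpace G := hG.completeSpace_coe
  set LG : G →L[ℂ] Y := L.comp G.subtypeL with hLG
  have hker : LG.ker = ⊥ := by
    rw [LinearMap.ker_eq_bot']
    intro x hx
    exact Subtype.ext ((Submodule.disjoint_def.1 hc.disjoint) x hx x.2)
  have hrange : LG.range = ⊤ := by
    rw [LinearMap.range_eq_top]
    intro y
    obtain ⟨x, rfl⟩ := hL y
    obtain ⟨u, hu, v, hv, rfl⟩ := Submodule.mem_sup.1 (hc.sup_eq_top ▸ Submodule.mem_top (x := x))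
    refine ⟨⟨v, hv⟩, ?_⟩
    have : L u = 0 := hu
    simp [hLG, this]
  set e := ContinuousLinearEquiv.ofBijective LG hker hrange with he
  refine ⟨G.subtypeL.comp e.symm.toContinuousLinearMap, fun y => ?_⟩
  exact ContinuousLinearEquiv.apply_symm_apply e y

/-- Appending finitely many conditions to a surjective operator with finite-dimensional kernel
gives a Fredholm operator. -/
theorem isFredholm_prod (L : X →L[ℂ] Y) (hL : Function.Surjective L)
    [FiniteDimensional ℂ L.ker] (B : X →L[ℂ] F) : (L.prod B).IsFredholm := by
  obtain ⟨R, hR⟩ := exists_rightInverse_of_finiteDimensional_ker L hL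
  -- The two compositions with `(y, d) ↦ R y` differ from the identity by operators with values in
  -- `ker L` and in `0 × F`, both finite-dimensional.
  refine ContinuousLinearMap.IsFredholm.of_isQuasiInverse
    (v := R.comp (ContinuousLinearMap.fst ℂ Y F)) ⟨?_, ?_⟩
  · refine LinearMap.FiniteRangeSetoid.equiv_iff_hasNoetherianRange.2 ?_
    have hN : IsNoetherian ℂ L.ker := inferInstance
    refine @isNoetherian_of_le _ _ _ _ _ _ L.ker hN ?_
    rintro _ ⟨x, rfl⟩
    simp [hR]
  · refine LinearMap.FiniteRangeSetoid.equiv_iff_hasNoetherianRange.2 ?_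
    have hN : IsNoetherian ℂ (LinearMap.range (LinearMap.inr ℂ Y F)) := inferInstance
    refine @isNoetherian_of_le _ _ _ _ _ _ (LinearMap.range (LinearMap.inr ℂ Y F)) hN ?_
    rintro _ ⟨x, rfl⟩
    exact ⟨B (R x.1) - x.2, by simp [hR, Prod.ext_iff]⟩

end Fredholm

/-! ### The Cauchy problem for `L` -/

section Main

variable {k n r m : ℕ} {p : ENNReal} {a b : ℝ} [hab : Fact (a < b)] [hp : Fact (1 ≤ p)]

open Sobolev

/-- The isomorphism `(W^n_p)^m × (ℂ^r)^m ≃ (W^(n+r)_p)^m` obtained from `integrateIter` in each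
component. -/
def integrateIterVec :
    (SobolevVec m n p a b × (Fin m → Fin r → ℂ)) ≃ₗ[ℂ] SobolevVec m (n + r) p a b where
  toFun x := WithLp.toLp 1 fun i => integrateIter r (x.1 i, x.2 i)
  map_add' x y := by
    ext i
    exact map_add (integrateIter r) (x.1 i, x.2 i) (y.1 i, y.2 i)
  map_smul' c x := by
    ext i
    exact map_smul (integrateIter r) c (x.1 i, x.2 i)
  invFun y := (WithLp.toLp 1 fun i => ((integrateIter r).symm (y i)).1,
    fun i => ((integrateIter r).symm (y i)).2)
  left_inv x := by
    refine Prod.ext ?_ ?_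
    · ext i
      simp
    · ext i
      simp
  right_inv y := by
    ext i
    simp

theorem primitive_pow_mem {f : Lp ℂ p (intervalMeasure a b)}
    (hf : f ∈ sobolevSubmodule k p a b) (i : ℕ) :
    ((primitive p : Lp ℂ p (intervalMeasure a b) →L[ℂ] _) ^ i) f ∈ sobolevSubmodule k p a b := by
  induction i with
  | zero => simpa using hf
  | succ i ih =>
    rw [pow_succ', mul_apply_eq_comp]
    exact sobolevSubmodule_succ_le _ (primitive_mem ih)

theorem derivativeLinfty_integrateIter (z : Sobolev n p a b) (j : ℕ) (hj : j < r) :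
    derivativeLinfty j (by omega) (integrateIter r (z, 0)) =
      primitive ⊤ (((primitive p : Lp ℂ p (intervalMeasure a b) →L[ℂ] _) ^ (r - 1 - j))
        z.toLp) := by
  refine Lp.ext ((coeFn_derivativeLinfty j (by omega) _).trans ?_)
  rw [derivative_integrateIter z j hj.le, show r - j = r - 1 - j + 1 by omega, pow_succ',
    mul_apply_eq_comp]
  exact (coeFn_primitive p _).trans (coeFn_primitive ⊤ _).symm

/-- The matrix entries of the coefficients as elements of `L_p`. -/
def coeffLp (A : Fin r → Matrix (Fin m) (Fin m) (Sobolev n p a b)) (j : Fin r) (i q : Fin m) :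
    Lp ℂ p (intervalMeasure a b) :=
  (A j i q).toLp

/-- Substituting the `r`-fold primitive of `z` for `y`, the leading term `y^(r) = z` gives the
identity and the lower-order terms give the Volterra operator. -/
theorem toLp_diffOp_integrateIterVec (A : Fin r → Matrix (Fin m) (Fin m) (Sobolev n p a b))
    (z : SobolevVec m n p a b) (i : Fin m) :
    (diffOp A (integrateIterVec (z, 0)) i).toLp =
      (1 + volterra (coeffLp A)) (fun q => (z q).toLp) i := by
  rw [toLp_diffOp, diffOpLp_apply, add_apply, one_apply_eq_self, Pi.add_apply,
    volterra_apply]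
  have h0 := derivative_integrateIter (z i) r le_rfl
  rw [Nat.sub_self, pow_zero] at h0
  refine congrArg₂ _ h0 (Finset.sum_congr rfl fun j _ => Finset.sum_congr rfl fun q _ => ?_)
  exact congrArg _ (derivativeLinfty_integrateIter (z q) j j.2)

/-- Solutions in `L_p` of the Volterra equation with data of class `W^n_p` are of class
`W^n_p`. -/
theorem mem_of_one_add_volterra_mem (A : Fin r → Matrix (Fin m) (Fin m) (Sobolev n p a b))
    {z f : Fin m → Lp ℂ p (intervalMeasure a b)}
    (hz : (1 + volterra (coeffLp A)) z = f)
    (hf : ∀ i, f i ∈ sobolevSubmodule n p a b) (hk : k ≤ n) (i : Fin m) :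
    z i ∈ sobolevSubmodule k p a b := by
  induction k generalizing i with
  | zero => exact mem_sobolevSubmodule_zero _
  | succ k ih =>
    -- Bootstrap: if `z` has order `k`, every term of `K z` contains at least one integration and so
    -- has order `k + 1`, as does `f`.
    have h : z i = f i - volterra (coeffLp A) z i := by
      rw [← hz]
      simp
    rw [h, volterra_apply]
    refine Submodule.sub_mem _ (sobolevSubmodule_anti hk (hf i))
      (Submodule.sum_mem _ fun j _ => Submodule.sum_mem _ fun q _ => ?_)
    refine mul_mem_succ (sobolevSubmodule_anti hk (A j i q).toLp_mem)
      (primitive_mem (primitive_pow_mem (ih (by omega) q) (r - 1 - j)))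
      ((coeFn_lpMul _ _).trans ?_)
    filter_upwards [coeFn_primitive p
        (((primitive p : Lp ℂ p (intervalMeasure a b) →L[ℂ] _) ^ (r - 1 - (j : ℕ))) (z q)),
      coeFn_primitive ⊤
        (((primitive p : Lp ℂ p (intervalMeasure a b) →L[ℂ] _) ^ (r - 1 - (j : ℕ))) (z q))]
      with t h1 h2
    rw [h1, h2]
    rfl

/-- The Cauchy problem with zero initial data is uniquely solvable. -/
theorem bijective_diffOp_integrateIterVec_inl
    (A : Fin r → Matrix (Fin m) (Fin m) (Sobolev n p a b)) :
    Function.Bijective (((diffOp A).toLinearMap ∘ₗ integrateIterVec.toLinearMap) ∘ₗ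
      LinearMap.inl ℂ (SobolevVec m n p a b) (Fin m → Fin r → ℂ)) := by
  obtain ⟨u, hu⟩ := isUnit_one_add_volterra (coeffLp A)
  constructor
  · rw [← LinearMap.ker_eq_bot, LinearMap.ker_eq_bot']
    intro z hz
    have h : u.val (fun q => (z q).toLp) = 0 := by
      ext1 i
      rw [hu, ← toLp_diffOp_integrateIterVec]
      exact congrArg (fun y : SobolevVec m n p a b => (y i).toLp) hz
    have h0 : (fun q => (z q).toLp) = 0 := by
      have := congrArg u⁻¹.val h
      rwa [map_zero, ← mul_apply_eq_comp, Units.inv_mul, one_apply_eq_self] at this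
    ext i
    exact toLp_injective (congrFun h0 i)
  · intro f
    -- The equation is solved in `L_p`, and regularity places the solution in `W^n_p`; no
    -- invertibility on `W^n_p` itself has to be estimated.
    set z := u⁻¹.val (fun q => (f q).toLp) with hz
    have h : (1 + volterra (coeffLp A)) z = fun q => (f q).toLp := by
      rw [← hu, hz, ← mul_apply_eq_comp, Units.mul_inv, one_apply_eq_self]
    have hmem := mem_of_one_add_volterra_mem A h (fun i => (f i).toLp_mem) le_rfl
    refine ⟨WithLp.toLp 1 fun i => ⟨z i, hmem i⟩, ?_⟩
    ext i
    refine toLp_injective ?_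
    refine (toLp_diffOp_integrateIterVec A _ i).trans ?_
    exact congrFun h i

theorem diffOp_surjective (A : Fin r → Matrix (Fin m) (Fin m) (Sobolev n p a b)) :
    Function.Surjective (diffOp A) := by
  have h := surjective_of_bijective_inl _ (bijective_diffOp_integrateIterVec_inl A)
  exact Function.Surjective.of_comp (g := integrateIterVec) h

/-- The solution space of `L y = 0` is isomorphic to the space of initial data. -/
def kerDiffOpEquiv (A : Fin r → Matrix (Fin m) (Fin m) (Sobolev n p a b)) :
    (diffOp A).ker ≃ₗ[ℂ] (Fin m → Fin r → ℂ) :=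
  (integrateIterVec.ofSubmodule' (diffOp A).ker).symm.trans
    (kerEquivOfBijectiveInl _ (bijective_diffOp_integrateIterVec_inl A))

end Main

end SobolevBVP

end

theorem theorem1 {n m r l : ℕ} (hm : 0 < m) (hr : 0 < r) (hl : 0 < l)
    {p : ENNReal} [Fact (1 ≤ p)] {a b : ℝ} [Fact (a < b)]
    (A : Fin r → Matrix (Fin m) (Fin m) (SobolevBVP.Sobolev n p a b))
    (B : SobolevBVP.SobolevVec m (n + r) p a b →L[ℂ] EuclideanSpace ℂ (Fin l)) :
    ∃ T : SobolevBVP.SobolevVec m (n + r) p a b →L[ℂ]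
        SobolevBVP.SobolevVec m n p a b × EuclideanSpace ℂ (Fin l),
      (∀ y : SobolevBVP.SobolevVec m (n + r) p a b,
        (∀ i : Fin m, ∀ᵐ t ∂(SobolevBVP.intervalMeasure a b),
          (T y).1 i t = SobolevBVP.diffExpr A y i t) ∧
        (T y).2 = B y) ∧
      T.IsFredholm ∧
      (Module.finrank ℂ T.ker : ℤ) -
          (Module.finrank ℂ
            ((SobolevBVP.SobolevVec m n p a b × EuclideanSpace ℂ (Fin l)) ⧸ T.range) : ℤ) =
        (r : ℤ) * (m : ℤ) - (l : ℤ) := by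
  have hL := SobolevBVP.diffOp_surjective A
  have e := SobolevBVP.kerDiffOpEquiv A
  have hfin : FiniteDimensional ℂ (SobolevBVP.diffOp A).ker := e.symm.finiteDimensional
  refine ⟨(SobolevBVP.diffOp A).prod B, fun y => ⟨fun i => ?_, rfl⟩,
    SobolevBVP.isFredholm_prod _ hL B, ?_⟩
  · exact SobolevBVP.coeFn_diffOpLp A i y
  · refine (SobolevBVP.finrank_ker_sub_finrank_coker_prod (SobolevBVP.diffOp A).toLinearMap hL
      B.toLinearMap).trans ?_
    rw [e.finrank_eq]
    simp [Module.finrank_pi_fintype, mul_comm]
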